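/- All graphs are finite and simple, and $|G|$ denotes the number of vertices of $G$. A graph $G$ \emph{contains} a graph $H$ if some induced subgraph of $G$ is isomorphic to $H$, and is \emph{$H$-free} otherwise. Disjoint sets $A,B\subseteq V(G)$ are \emph{anticomplete} if no vertex of $A$ has a neighbour in $B$. For real $\epsilon>0$, a graph $G$ is \emph{$\epsilon$-coherent} if $|G|>1$, every vertex of $G$ has degree less than $\epsilon|G|$, and there do not exist disjoint anticomplete sets $A,B\subseteq V(G)$ with $|A|,|B|\ge\epsilon|G|$. Theorem. (1) For every forest $H$ there exists $\epsilon>0$ such that for every $H$-free graph $G$ with $|G|>1$, either some vertex of $G$ has degree at least $\epsilon|G|$, or there exist disjoint anticomplete sets $A,B\subseteq V(G)$ with $|A|,|B|\ge\epsilon|G|$. (2) (An equivalent form of (1).) For every tree $T$ there exists $\epsilon>0$ such that every $\epsilon$-coherent graph contains $T$. -/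

import Mathlib

/-- Two disjoint vertex sets `A`, `B` of a graph are anticomplete if no vertex in `A` has a
neighbour in `B`. -/
def SimpleGraph.IsAnticompletePair {V : Type*} (G : SimpleGraph V) (A B : Finset V) : Prop :=
  Disjoint A B ∧ ∀ a ∈ A, ∀ b ∈ B, ¬ G.Adj a b

/-- A finite graph `G` is `ε`-coherent if it has more than one vertex, every vertex has degree
less than `ε |G|`, and there are no disjoint anticomplete vertex sets `A`, `B` with
`|A|, |B| ≥ ε |G|`. The definition is intended for `ε > 0`. -/
structure SimpleGraph.IsCoherent {V : Type*} [Fintype V] (G : SimpleGraph V)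
    [DecidableRel G.Adj] (ε : ℝ) : Prop where
  one_lt_card : 1 < Fintype.card V
  degree_lt : ∀ v : V, (G.degree v : ℝ) < ε * (Fintype.card V : ℝ)
  not_exists_anticomplete : ¬ ∃ A B : Finset V, G.IsAnticompletePair A B ∧
    ε * (Fintype.card V : ℝ) ≤ (A.card : ℝ) ∧ ε * (Fintype.card V : ℝ) ≤ (B.card : ℝ)

/-! Put `E = ⌈ε|G|⌉`. Every vertex has at most `E` neighbours, and any two disjoint sets of size at
least `E` are joined by an edge. Take boundedly many disjoint blocks, each much larger than `E`. A
pattern is a graph on a set of block indices; it is present if some transversal of these blocks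
induces it. There are finitely many patterns, so after finitely many shrinkings the blocks are
stable: a present pattern survives when its blocks are cut down to any subsets of a fixed proportion
(`exists_isStable`).

Stability yields the dichotomy `AttachOrLink` (`IsStable.attachOrLink`). Suppose present patterns
have their roots in `Y` and their other vertices in `K`. Let `D` be the largest degree into what
remains of a block of `C` that a fixed proportion of some block of `Y ∪ K` attains. If many vertices
of a block `u ∈ K` have degree comparable to `D` into block `x`, a greedily chosen part of block `x`
hits a fair share of block `u` but misses much of the others, and stability produces a leaf at `u`.
Otherwise vertices of `K` typically have much smaller degree, so a copy can be found whose root has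
many neighbours that its other vertices miss. Setting these aside, deleting the neighbourhood of the
copy and repeating yields many vertices that see only the root of a copy; stability then links
patterns by a single edge.

By Ramsey's theorem there is a large index set `H` on whose subsets the presence of the relevant
trees depends only on size. Three quantities are tracked: the order `a` of a binomial tree rooted at
its largest index, the order `b` of one rooted at its smallest, and the number `s` of vertices built
of the wanted tree. The dichotomy, applied to `Y₁ < K₁ < C < K₂ < Y₂` in `H`, raises one of them
(`IsHomogeneous.exists_larger_tree`): a new leaf raises `s`, a link joins two binomial trees. Since
binomial trees contain all small trees, the wanted tree appears once any of the three reaches `m`.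
Forests are induced subgraphs of trees, so both parts follow. -/

section

open Finset

/-! ### Ramsey's theorem -/

/-- Ramsey's theorem for finite uniform hypergraphs. -/
theorem exists_uniform_ramsey (κ : Type) [Finite κ] (q : ℕ) : ∀ h : ℕ, ∃ N : ℕ,
    ∀ {α : Type} (X : Finset α) (c : Finset α → κ), N ≤ #X →
      ∃ H ⊆ X, #H = h ∧ ∀ A ⊆ H, ∀ B ⊆ H, #A = q → #B = q → c A = c B := by
  classical
  have := Fintype.ofFinite κ
  induction q with
  | zero =>
    intro h
    refine ⟨h, fun X c hX => ?_⟩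
    obtain ⟨H, hH, hc⟩ := exists_subset_card_eq hX
    refine ⟨H, hH, hc, fun A _ B _ hA hB => ?_⟩
    rw [card_eq_zero.1 hA, card_eq_zero.1 hB]
  | succ q ih =>
    -- sequences in which the colour of a set is determined by its first element
    have key : ∀ l : ℕ, ∃ N : ℕ, ∀ {α : Type} (X : Finset α) (c : Finset α → κ), N ≤ #X →
        ∃ xs : List α, xs.length = l ∧ xs.Nodup ∧ (∀ x ∈ xs, x ∈ X) ∧ ∃ d : α → κ,
          ∀ ys : List α, ∀ y, (y :: ys).Sublist xs → ys.length = q →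
            c (insert y ys.toFinset) = d y := by
      intro l
      induction l with
      | zero =>
        refine ⟨1, fun {α} X c hX => ⟨[], rfl, List.nodup_nil, by simp, ?_⟩⟩
        obtain ⟨x, -⟩ := card_pos.1 (by omega : 0 < #X)
        refine ⟨fun _ => c ∅, fun ys y h => ?_⟩
        simp at h
      | succ l ihl =>
        obtain ⟨N₁, hN₁⟩ := ihl
        -- The maximum with `q` ensures that a `q`-subset `A₀` exists to supply the colour assigned
        -- to `x`.
        obtain ⟨N₂, hN₂⟩ := ih (max N₁ q)
        refine ⟨N₂ + 1, fun {α} X c hX => ?_⟩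
        obtain ⟨x, hx⟩ := card_pos.1 (by omega : 0 < #X)
        obtain ⟨H, hH, hHc, hhom⟩ := hN₂ (X.erase x) (fun A => c (insert x A))
          (by rw [card_erase_of_mem hx]; omega)
        obtain ⟨xs, hl, hnd, hmem, d, hd⟩ := hN₁ H c (by omega)
        obtain ⟨A₀, hA₀, hA₀c⟩ := exists_subset_card_eq (s := H) (n := q) (by omega)
        have hxH : x ∉ H := fun h => by simpa using hH h
        have hxxs : x ∉ xs := fun h => hxH (hmem x h)
        refine ⟨x :: xs, by simp [hl], List.nodup_cons.2 ⟨hxxs, hnd⟩, ?_,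
          Function.update d x (c (insert x A₀)), ?_⟩
        · intro z hz
          rcases List.mem_cons.1 hz with rfl | hz
          · exact hx
          · exact (mem_erase.1 (hH (hmem z hz))).2
        · intro ys y hsub hlen
          by_cases hyx : y = x
          · subst hyx
            have h1 : ys.Sublist xs := List.cons_sublist_cons.1 hsub
            rw [Function.update_self]
            refine hhom _ ?_ _ hA₀ ?_ hA₀c
            · intro z hz
              exact hmem z (h1.subset (List.mem_toFinset.1 hz))
            · rw [List.toFinset_card_of_nodup (hnd.sublist h1), hlen]
          · rw [Function.update_of_ne hyx]
            refine hd ys y ?_ hlen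
            cases hsub with
            | cons _ h => exact h
            | cons_cons _ h => exact absurd rfl hyx
    intro h
    obtain ⟨N, hN⟩ := key (Fintype.card κ * h)
    refine ⟨N, fun {α} X c hX => ?_⟩
    obtain ⟨xs, hl, hnd, hmem, d, hd⟩ := hN X c hX
    have : Nonempty κ := ⟨c ∅⟩
    have hcard : #xs.toFinset = Fintype.card κ * h := by
      rw [List.toFinset_card_of_nodup hnd, hl]
    obtain ⟨k, -, hk⟩ := exists_le_card_fiber_of_mul_le_card_of_maps_to
      (s := xs.toFinset) (t := univ) (f := d) (n := h) (fun _ _ => mem_univ _)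
      univ_nonempty (by rw [hcard, card_univ])
    obtain ⟨H, hH, hHc⟩ := exists_subset_card_eq hk
    have hcol : ∀ A ⊆ H, #A = q + 1 → c A = k := by
      intro A hA hAc
      set zs := xs.filter (· ∈ A) with hzs
      have hzsub : zs.Sublist xs := List.filter_sublist
      have hzA : zs.toFinset = A := by
        ext a
        simp only [hzs, List.mem_toFinset, List.mem_filter, decide_eq_true_eq]
        refine ⟨fun h => h.2, fun h => ⟨?_, h⟩⟩
        exact List.mem_toFinset.1 (mem_filter.1 (hH (hA h))).1
      have hzl : zs.length = q + 1 := by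
        rw [← List.toFinset_card_of_nodup (hnd.sublist hzsub), hzA, hAc]
      match zs with
      | [] => simp at hzl
      | y :: ys =>
        have := hd ys y hzsub (by simpa using hzl)
        rw [← List.toFinset_cons, hzA] at this
        rw [this]
        have hyA : y ∈ A := by rw [← hzA]; simp
        exact (mem_filter.1 (hH (hA hyA))).2
    refine ⟨H, fun z hz => hmem z (List.mem_toFinset.1 (mem_filter.1 (hH hz)).1), hHc, ?_⟩
    intro A hA B hB hAc hBc
    rw [hcol A hA hAc, hcol B hB hBc]

/-- Ramsey's theorem for colourings of all sets of bounded size at once. -/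
theorem exists_bounded_ramsey (κ : Type) [Finite κ] (Q h : ℕ) : ∃ N : ℕ,
    ∀ {α : Type} (X : Finset α) (c : Finset α → κ), N ≤ #X →
      ∃ H ⊆ X, #H = h ∧ ∀ A ⊆ H, ∀ B ⊆ H, #A = #B → #A ≤ Q → c A = c B := by
  induction Q with
  | zero =>
    obtain ⟨N, hN⟩ := exists_uniform_ramsey κ 0 h
    refine ⟨N, fun X c hX => ?_⟩
    obtain ⟨H, hH, hc, hh⟩ := hN X c hX
    exact ⟨H, hH, hc, fun A hA B hB h1 h2 => hh A hA B hB (by omega) (by omega)⟩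
  | succ Q ih =>
    obtain ⟨N₁, hN₁⟩ := ih
    obtain ⟨N, hN⟩ := exists_uniform_ramsey κ (Q + 1) N₁
    refine ⟨N, fun X c hX => ?_⟩
    obtain ⟨H₁, hH₁, hc₁, hh₁⟩ := hN X c hX
    obtain ⟨H, hH, hc, hh⟩ := hN₁ H₁ c hc₁.ge
    refine ⟨H, hH.trans hH₁, hc, fun A hA B hB h1 h2 => ?_⟩
    by_cases h3 : #A = Q + 1
    · exact hh₁ A (hA.trans hH) B (hB.trans hH) h3 (by omega)
    · exact hh A hA B hB h1 (by omega)

/-! ### Patterns in blocks and stability -/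

section Blocks

open scoped Classical

variable {V L : Type*}

/-- `f` picks one vertex from each block `B i`, `i ∈ Z`, and these vertices induce a copy of the
subgraph of `τ` induced on `Z`. -/
def IsCopy (G : SimpleGraph V) (B : L → Finset V) (Z : Finset L) (τ : SimpleGraph L)
    (f : L → V) : Prop :=
  (∀ i ∈ Z, f i ∈ B i) ∧ ∀ i ∈ Z, ∀ j ∈ Z, G.Adj (f i) (f j) ↔ τ.Adj i j

/-- The blocks `B i`, `i ∈ Z`, have a transversal inducing a copy of `τ` on `Z`. -/
def IsPresent (G : SimpleGraph V) (B : L → Finset V) (Z : Finset L) (τ : SimpleGraph L) : Prop :=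
  ∃ f, IsCopy G B Z τ f

/-- Every pattern present in the blocks `B` is present in any choice of subsets of these blocks
of sizes at least `S / q`. -/
def IsStable (G : SimpleGraph V) (B : L → Finset V) (S q : ℕ) : Prop :=
  ∀ Z τ, IsPresent G B Z τ → ∀ B' : L → Finset V, (∀ i ∈ Z, B' i ⊆ B i) →
    (∀ i ∈ Z, S ≤ q * #(B' i)) → IsPresent G B' Z τ

theorem IsPresent.mono {G : SimpleGraph V} {B B' : L → Finset V} {Z Z' : Finset L}
    {τ τ' : SimpleGraph L} (h : IsPresent G B Z τ) (hZ : Z' ⊆ Z) (hB : ∀ i ∈ Z', B i ⊆ B' i)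
    (hτ : ∀ i ∈ Z', ∀ j ∈ Z', τ.Adj i j ↔ τ'.Adj i j) : IsPresent G B' Z' τ' := by
  obtain ⟨f, hf, hadj⟩ := h
  exact ⟨f, fun i hi => hB i hi (hf i (hZ hi)), fun i hi j hj =>
    (hadj i (hZ hi) j (hZ hj)).trans (hτ i hi j hj)⟩

/-- If stability fails, cutting all blocks down to a proportion `1 / q` destroys a present pattern
and creates none. This can happen at most `k` times. -/
theorem exists_isStable [Finite L] (G : SimpleGraph V) {q : ℕ} (hq : 1 ≤ q) (k : ℕ) :
    ∀ (B : L → Finset V) (S : ℕ), (∀ i, #(B i) = S) →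
      {x : Finset L × SimpleGraph L | IsPresent G B x.1 x.2}.ncard ≤ k →
      ∃ (B' : L → Finset V) (S' : ℕ), (∀ i, B' i ⊆ B i) ∧ (∀ i, #(B' i) = S') ∧
        S ≤ q ^ k * S' ∧ IsStable G B' S' q := by
  induction k with
  | zero =>
    intro B S hB hk
    refine ⟨B, S, fun i => Subset.rfl, hB, by simp, fun Z τ h => ?_⟩
    rw [Nat.le_zero, Set.ncard_eq_zero (Set.toFinite _)] at hk
    exact absurd h (Set.eq_empty_iff_forall_notMem.1 hk (Z, τ))
  | succ k ih =>
    intro B S hB hk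
    by_cases hst : IsStable G B S q
    · refine ⟨B, S, fun i => Subset.rfl, hB, ?_, hst⟩
      exact Nat.le_mul_of_pos_left _ (pow_pos hq _)
    · simp only [IsStable, not_forall] at hst
      obtain ⟨Z, τ, hpres, B₁, hB₁, hcard, hnot⟩ := hst
      -- The ceiling of `S / q`, the least size that the definition of stability allows.
      set S₁ := (S + q - 1) / q with hS₁
      have h1 : S ≤ q * S₁ := by
        have := Nat.lt_mul_div_succ (S + q - 1) hq
        rw [mul_add, ← hS₁] at this
        omega
      have h2 : ∀ b, S ≤ q * b → S₁ ≤ b := by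
        intro b hb
        rw [hS₁, ← Nat.lt_succ_iff, Nat.div_lt_iff_lt_mul hq, Nat.succ_mul, mul_comm b]
        omega
      have h3 : ∀ i, ∃ C ⊆ (if i ∈ Z then B₁ i else B i), #C = S₁ := by
        intro i
        apply exists_subset_card_eq
        split_ifs with hi
        · exact h2 _ (hcard i hi)
        · rw [hB]
          exact h2 _ (Nat.le_mul_of_pos_left _ hq)
      choose B₂ hB₂ hB₂c using h3
      have hsub : ∀ i, B₂ i ⊆ B i := by
        intro i
        refine (hB₂ i).trans ?_
        split_ifs with hi
        · exact hB₁ i hi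
        · exact Subset.rfl
      obtain ⟨B', S', hB', hS', hle, hst⟩ := ih B₂ S₁ hB₂c (by
        rw [← Nat.lt_succ_iff]
        refine lt_of_lt_of_le (Set.ncard_lt_ncard ?_ (Set.toFinite _)) hk
        refine ⟨fun x hx => IsPresent.mono hx Subset.rfl (fun i _ => hsub i)
          fun _ _ _ _ => Iff.rfl, fun hle => hnot ?_⟩
        have : IsPresent G B₂ Z τ := @hle (Z, τ) hpres
        refine this.mono Subset.rfl (fun i hi => ?_) fun _ _ _ _ => Iff.rfl
        have := hB₂ i
        rwa [if_pos hi] at this)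
      refine ⟨B', S', fun i => (hB' i).trans (hsub i), hS', ?_, hst⟩
      calc S ≤ q * S₁ := h1
        _ ≤ q * (q ^ k * S') := Nat.mul_le_mul_left _ hle
        _ = q ^ (k + 1) * S' := by ring

/-! ### Greedy covering by neighbourhoods -/

/-- The vertices of `X` with a neighbour in `R`. -/
noncomputable def hit (G : SimpleGraph V) (R X : Finset V) : Finset V :=
  X.filter fun v => ∃ w ∈ R, G.Adj w v

theorem hit_subset (G : SimpleGraph V) (R X : Finset V) : hit G R X ⊆ X := filter_subset _ _

theorem card_hit_insert (G : SimpleGraph V) (R X : Finset V) (w : V) :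
    #(hit G (insert w R) X) = #(hit G R X) + #((X \ hit G R X).filter (G.Adj w)) := by
  rw [← card_union_of_disjoint]
  · congr 1
    ext v
    simp only [hit, mem_filter, mem_insert, mem_union, mem_sdiff, exists_eq_or_imp]
    by_cases h1 : ∃ a ∈ R, G.Adj a v <;> by_cases h2 : v ∈ X <;> simp [h1, h2]
  · exact disjoint_of_subset_right (filter_subset _ _) disjoint_sdiff

theorem sum_card_filter_adj_comm (G : SimpleGraph V) (W X : Finset V) :
    ∑ w ∈ W, #(X.filter (G.Adj w)) = ∑ v ∈ X, #(W.filter (G.Adj v)) := by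
  have := sum_card_bipartiteAbove_eq_sum_card_bipartiteBelow (s := W) (t := X) G.Adj
  simpa only [bipartiteAbove, bipartiteBelow, G.adj_comm] using this

/-- `R` grows one vertex at a time. While fewer than half of `Q` is hit, double counting edges to
`W` finds a vertex whose new hits in the sets `low z` total less than `t` times its new hits in `Q`.
Each vertex adds at most `E` hits, hence the overshoot in the upper bound. -/
theorem exists_hit {ι : Type*} (G : SimpleGraph V) {E : ℕ}
    (hdeg : ∀ v (X : Finset V), #(X.filter (G.Adj v)) ≤ E)
    (W Q : Finset V) (I : Finset ι) (low : ι → Finset V) {D κ p S N h t : ℕ} (hD : 1 ≤ D)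
    (hI : #I ≤ N) (hQ : ∀ v ∈ Q, D ≤ κ * #(W.filter (G.Adj v)))
    (hlow : ∀ z ∈ I, ∀ v ∈ low z, #(W.filter (G.Adj v)) ≤ D)
    (hS : ∀ z ∈ I, #(low z) ≤ S) (hSQ : S ≤ p * #Q) (hh : 2 * h ≤ #Q)
    (ht : 2 * κ * N * p < t) :
    ∃ R ⊆ W, h ≤ #(hit G R Q) ∧ #(hit G R Q) ≤ h + E ∧
      ∑ z ∈ I, #(hit G R (low z)) ≤ t * #(hit G R Q) := by
  suffices H : ∀ j ≤ h, ∃ R ⊆ W, j ≤ #(hit G R Q) ∧ #(hit G R Q) ≤ h + E ∧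
      ∑ z ∈ I, #(hit G R (low z)) ≤ t * #(hit G R Q) from H h le_rfl
  intro j
  induction j with
  | zero => exact fun _ => ⟨∅, by simp, by simp, by simp [hit], by simp [hit]⟩
  | succ j ih =>
    intro hj
    obtain ⟨R, hRW, h1, h2, h3⟩ := ih (by omega)
    by_cases h4 : j + 1 ≤ #(hit G R Q)
    · exact ⟨R, hRW, h4, h2, h3⟩
    -- Otherwise summing over `W` bounds `t` times the edges from the unhit half of `Q`, at least `D
    -- / κ` per vertex, by the at most `N * S * D` edges from the low sets. This contradicts `t > 2
    -- * κ * N * p`.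
    have hex : ∃ w ∈ W, ∑ z ∈ I, #((low z \ hit G R (low z)).filter (G.Adj w)) <
        t * #((Q \ hit G R Q).filter (G.Adj w)) := by
      by_contra! hcon
      have a1 := sum_le_sum hcon
      rw [← mul_sum, sum_card_filter_adj_comm, sum_comm] at a1
      have a2 : ∑ z ∈ I, ∑ w ∈ W, #((low z \ hit G R (low z)).filter (G.Adj w)) ≤
          N * (S * D) := by
        calc _ ≤ ∑ z ∈ I, S * D := by
              refine sum_le_sum fun z hz => ?_
              rw [sum_card_filter_adj_comm]
              calc _ ≤ ∑ v ∈ low z \ hit G R (low z), D :=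
                    sum_le_sum fun v hv => hlow z hz v (mem_sdiff.1 hv).1
                _ ≤ S * D := by
                    rw [sum_const, smul_eq_mul]
                    exact Nat.mul_le_mul_right _ ((card_le_card sdiff_subset).trans (hS z hz))
          _ ≤ N * (S * D) := by
              rw [sum_const, smul_eq_mul]
              exact Nat.mul_le_mul_right _ hI
      have a3 : D * #(Q \ hit G R Q) ≤ κ * ∑ v ∈ Q \ hit G R Q, #(W.filter (G.Adj v)) := by
        rw [mul_sum, mul_comm, ← smul_eq_mul, ← sum_const]
        exact sum_le_sum fun v hv => hQ v (mem_sdiff.1 hv).1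
      have a4 : #Q ≤ 2 * #(Q \ hit G R Q) := by
        rw [card_sdiff_of_subset (hit_subset _ _ _)]
        omega
      have a5 : t * (D * #Q) ≤ (2 * κ * N * p) * (D * #Q) := by
        calc t * (D * #Q) ≤ t * (D * (2 * #(Q \ hit G R Q))) := by gcongr
          _ = 2 * t * (D * #(Q \ hit G R Q)) := by ring
          _ ≤ 2 * t * (κ * ∑ v ∈ Q \ hit G R Q, #(W.filter (G.Adj v))) := by gcongr
          _ = 2 * κ * (t * ∑ v ∈ Q \ hit G R Q, #(W.filter (G.Adj v))) := by ring
          _ ≤ 2 * κ * (N * (S * D)) := Nat.mul_le_mul_left _ (a1.trans a2)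
          _ ≤ 2 * κ * (N * (p * #Q * D)) := by gcongr
          _ = _ := by ring
      have a6 : 0 < D * #Q := Nat.mul_pos hD (by omega)
      exact absurd (Nat.le_of_mul_le_mul_right a5 a6) (by omega)
    obtain ⟨w, hw, hlt⟩ := hex
    have hpos : 0 < #((Q \ hit G R Q).filter (G.Adj w)) := by
      rcases Nat.eq_zero_or_pos #((Q \ hit G R Q).filter (G.Adj w)) with h0 | h0
      · rw [h0] at hlt
        omega
      · exact h0
    have hE := hdeg w (Q \ hit G R Q)
    refine ⟨insert w R, insert_subset hw hRW, ?_, ?_, ?_⟩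
    · rw [card_hit_insert]
      omega
    · rw [card_hit_insert]
      omega
    · simp only [card_hit_insert, sum_add_distrib, mul_add]
      omega

end Blocks

/-! ### Attaching a leaf -/

section Blocks

open scoped Classical

variable {V L : Type*} [DecidableEq L]

/-- Apply `exists_hit` to the high-degree part of block `u` and the vertices of degree at most `D`
in the other blocks of `Z`. By stability the pattern survives on the hit part of block `u` and the
unhit parts elsewhere. -/
theorem IsPresent.attach_leaf {G : SimpleGraph V} {B : L → Finset V} {E S N D : ℕ}
    (hdeg : ∀ v (X : Finset V), #(X.filter (G.Adj v)) ≤ E) (hE : 1 ≤ E)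
    (hN : ∀ X : Finset L, #X ≤ N) (hB : ∀ i, #(B i) = S) (hS : 1000 * N ^ 3 * E ≤ S)
    (hst : IsStable G B S (200 * N ^ 3)) {J : Finset L} {x u : L} (hx : x ∉ J)
    {W : Finset V} (hW : W ⊆ B x) (hD : 1 ≤ D)
    (hu : S ≤ 2 * N * #((B u).filter fun v => D ≤ 2 * N * #(W.filter (G.Adj v))))
    (hlow : ∀ z ∈ J, 2 * N * #((B z).filter fun v => D + 1 ≤ #(W.filter (G.Adj v))) < S)
    {Z : Finset L} (hZ : Z ⊆ J) (huZ : u ∈ Z) {τ τ' : SimpleGraph L} (h : IsPresent G B Z τ)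
    (hτ : ∀ i ∈ Z, ∀ j ∈ Z, τ.Adj i j ↔ τ'.Adj i j) (hxu : ∀ i ∈ Z, τ'.Adj x i ↔ i = u) :
    IsPresent G B (insert x Z) τ' := by
  have hN1 : 1 ≤ N := (card_pos.2 ⟨u, huZ⟩).trans_le (hN Z)
  have hN3 : 1 ≤ N ^ 3 := Nat.one_le_pow _ _ hN1
  obtain ⟨M, hM⟩ : ∃ M, M = N ^ 3 := ⟨_, rfl⟩
  set Q := (B u).filter fun v => D ≤ 2 * N * #(W.filter (G.Adj v)) with hQdef
  set low : L → Finset V := fun z => (B z).filter fun v => #(W.filter (G.Adj v)) ≤ D with hlowdef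
  obtain ⟨t, ht⟩ : ∃ t, t = 2 * (2 * N) * N * (2 * N) + 1 := ⟨_, rfl⟩
  have ht' : t = 8 * M + 1 := by rw [ht, hM]; ring
  -- With this choice `R` hits at most `t * (h₀ + E)` low vertices, barely more than `S / 8`, while
  -- each low set has over `S / 2`.
  obtain ⟨h₀, hh₀⟩ : ∃ h₀, h₀ = S / (8 * t) := ⟨_, rfl⟩
  have e1 : 8 * t * h₀ ≤ S := by rw [hh₀]; exact Nat.mul_div_le _ _
  have e2 : S < 8 * t * (h₀ + 1) := by rw [hh₀]; exact Nat.lt_mul_div_succ _ (by omega)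
  have e3 : 1000 * M ≤ S := by
    rw [hM]; exact le_trans (Nat.le_mul_of_pos_right _ hE) hS
  have e4 : 1 ≤ h₀ := by
    by_contra hcon
    have : h₀ = 0 := by omega
    subst this
    rw [ht', hM] at e2
    rw [hM] at e3
    omega
  have e5 : S ≤ 200 * N ^ 3 * h₀ := by
    rw [← hM]
    rw [← hM] at hN3
    calc S ≤ 8 * t * (h₀ + 1) := e2.le
      _ ≤ 8 * (9 * M) * (2 * h₀) := by gcongr <;> omega
      _ = 144 * M * h₀ := by ring
      _ ≤ 200 * M * h₀ := by gcongr; omega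
  have e6 : 2 * h₀ ≤ #Q := by
    have : 2 * N * (2 * h₀) ≤ 2 * N * #Q := by
      refine le_trans ?_ hu
      refine le_trans ?_ e1
      have : N ≤ M := by rw [hM]; exact Nat.le_self_pow (by norm_num) _
      calc 2 * N * (2 * h₀) = 4 * N * h₀ := by ring
        _ ≤ 8 * t * h₀ := by gcongr <;> omega
    exact Nat.le_of_mul_le_mul_left this (by omega)
  obtain ⟨R, hRW, hR1, hR2, hR3⟩ := exists_hit G hdeg W Q (Z.erase u) low (h := h₀) (N := N)
    (κ := 2 * N) (p := 2 * N) (S := S) (t := t) hD (hN _)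
    (fun v hv => (mem_filter.1 hv).2) (fun z _ v hv => (mem_filter.1 hv).2)
    (fun z _ => (card_le_card (filter_subset _ _)).trans (hB z).le) hu e6 (by omega)
  have e7 : ∀ z ∈ Z.erase u, S ≤ 4 * #(low z \ hit G R (low z)) := by
    intro z hz
    have f1 := single_le_sum (f := fun z => #(hit G R (low z))) (fun _ _ => Nat.zero_le _) hz
    have f2 : t * #(hit G R Q) ≤ t * h₀ + t * E := by
      rw [← mul_add]; exact Nat.mul_le_mul_left _ hR2
    have f3 : t * E ≤ 9 * (M * E) := by
      rw [← mul_assoc]; exact Nat.mul_le_mul_right _ (by rw [← hM] at hN3; omega)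
    have f4 : 1000 * (M * E) ≤ S := by rw [← mul_assoc, hM]; exact hS
    have f5 := hlow z (hZ (mem_of_mem_erase hz))
    have f6 : #(low z) + #((B z).filter fun v => D + 1 ≤ #(W.filter (G.Adj v))) = S := by
      rw [← hB z, ← card_filter_add_card_filter_not (s := B z)
        (fun v => #(W.filter (G.Adj v)) ≤ D)]
      congr 2
      exact filter_congr fun v _ => by rw [not_le, Nat.lt_iff_add_one_le]
    have f7 : 2 * #((B z).filter fun v => D + 1 ≤ #(W.filter (G.Adj v))) < S :=
      lt_of_le_of_lt (Nat.mul_le_mul_right _ (by omega)) f5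
    have f8 : 8 * (t * h₀) ≤ S := by rw [← mul_assoc]; exact e1
    rw [card_sdiff_of_subset (hit_subset _ _ _)]
    omega
  obtain ⟨g, hg, hadj⟩ := hst Z τ h
    (fun z => if z = u then hit G R Q else low z \ hit G R (low z))
    (fun z _ => by
      split_ifs with hzu
      · rw [hzu]
        exact (hit_subset _ _ _).trans (filter_subset _ _)
      · exact sdiff_subset.trans (filter_subset _ _))
    (fun z hz => by
      split_ifs with hzu
      · exact e5.trans (Nat.mul_le_mul_left _ hR1)
      · refine (e7 z (mem_erase.2 ⟨hzu, hz⟩)).trans (Nat.mul_le_mul_right _ (by omega)))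
  dsimp only at hg
  have hgu := hg u huZ
  rw [if_pos rfl] at hgu
  -- Any neighbour `w ∈ R` of the vertex chosen in block `u` serves as the leaf, since the other
  -- chosen vertices are not hit by `R`.
  obtain ⟨w, hwR, hw⟩ := (mem_filter.1 hgu).2
  have hxZ : ∀ i ∈ Z, i ≠ x := fun i hi h => hx (hZ (h ▸ hi))
  have hgz : ∀ i ∈ Z, G.Adj w (g i) ↔ i = u := by
    intro i hi
    refine ⟨fun hwi => ?_, fun h => h ▸ hw⟩
    by_contra hiu
    have := hg i hi
    rw [if_neg hiu, mem_sdiff] at this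
    exact this.2 (mem_filter.2 ⟨this.1, w, hwR, hwi⟩)
  have hgB : ∀ i ∈ Z, g i ∈ B i := by
    intro i hi
    have := hg i hi
    split_ifs at this with hiu
    · subst hiu
      exact (mem_filter.1 ((hit_subset _ _ _) this)).1
    · exact (mem_filter.1 (mem_sdiff.1 this).1).1
  refine ⟨Function.update g x w, fun i hi => ?_, fun i hi j hj => ?_⟩
  · rcases mem_insert.1 hi with rfl | hi
    · rw [Function.update_self]
      exact hW (hRW hwR)
    · rw [Function.update_of_ne (hxZ i hi)]
      exact hgB i hi
  · rcases mem_insert.1 hi with rfl | hi₁ <;> rcases mem_insert.1 hj with rfl | hj₁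
    · simp
    · rw [Function.update_self, Function.update_of_ne (hxZ j hj₁), hgz j hj₁, hxu j hj₁]
    · rw [Function.update_self, Function.update_of_ne (hxZ i hi₁), G.adj_comm, τ'.adj_comm,
        hgz i hi₁, hxu i hi₁]
    · rw [Function.update_of_ne (hxZ j hj₁), Function.update_of_ne (hxZ i hi₁), hadj i hi₁ j hj₁,
        hτ i hi₁ j hj₁]

/-! ### Collecting vertices that see only the root of a copy -/

/-- A partial result of the search for a vertex set that can be linked to copies of the patterns
`τ y`, `y ∈ Y`: the sets `Good y x` consist of vertices attached to the root of such a copy, and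
these copies have no neighbours in the remaining parts `W x` of the blocks `B x`. -/
structure LinkState (G : SimpleGraph V) (B : L → Finset V) (S : ℕ) (Y C : Finset L)
    (Zy : L → Finset L) (τ : L → SimpleGraph L) (s : ℕ) (W : L → Finset V)
    (Good : L → L → Finset V) : Prop where
  rest_subset : ∀ x ∈ C, W x ⊆ B x
  le_rest : ∀ x ∈ C, S ≤ #(W x) + 2 * s
  good_subset : ∀ y ∈ Y, ∀ x ∈ C, Good y x ⊆ B x
  disj : ∀ y ∈ Y, ∀ x ∈ C, Disjoint (Good y x) (W x)
  good : ∀ y ∈ Y, ∀ x ∈ C, ∀ w ∈ Good y x, ∃ f, IsCopy G B (Zy y) (τ y) f ∧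
    (∀ i ∈ Zy y, G.Adj (f i) w ↔ i = y) ∧ ∀ i ∈ Zy y, ∀ x' ∈ C, ∀ w' ∈ W x', ¬ G.Adj (f i) w'
  le_good : s ≤ 2 * ∑ y ∈ Y, ∑ x ∈ C, #(Good y x)

/-- Stability gives a copy whose root has at least `D` neighbours in `W x₀`, while each other vertex
has fewer than `D / (2N)` in every `W x`. Together the others spoil at most half of the neighbours
of the root. -/
theorem LinkState.extend {G : SimpleGraph V} {B : L → Finset V} {E S N D s : ℕ}
    (hdeg : ∀ v (X : Finset V), #(X.filter (G.Adj v)) ≤ E)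
    (hN : ∀ X : Finset L, #X ≤ N) (hB : ∀ i, #(B i) = S)
    (hst : IsStable G B S (200 * N ^ 3)) {Y K C : Finset L}
    {Zy : L → Finset L} {τ : L → SimpleGraph L} {W : L → Finset V} {Good : L → L → Finset V}
    (hstate : LinkState G B S Y C Zy τ s W Good) {y x₀ : L} (hy : y ∈ Y) (hx₀ : x₀ ∈ C)
    (hZK : Zy y ⊆ insert y K) (hyZ : y ∈ Zy y)
    (hpres : IsPresent G B (Zy y) (τ y)) (hD : 1 ≤ D)
    (hP : S ≤ 2 * N * #((B y).filter fun v => D ≤ #((W x₀).filter (G.Adj v))))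
    (hlow : ∀ u ∈ K, ∀ x ∈ C,
      2 * N * #((B u).filter fun v => D ≤ 2 * N * #((W x).filter (G.Adj v))) < S) :
    ∃ s' W' Good', s < s' ∧ s' ≤ s + E ∧ LinkState G B S Y C Zy τ s' W' Good' := by
  have hN1 : 1 ≤ N := (card_pos.2 ⟨y, hy⟩).trans_le (hN Y)
  have hN3 : N ≤ N ^ 3 := Nat.le_self_pow (by norm_num) _
  set P := (B y).filter fun v => D ≤ #((W x₀).filter (G.Adj v)) with hPdef
  -- Each of the at most `N` indices `x` excludes fewer than `S / (2N)` vertices of a block, so at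
  -- least half of it is left.
  set low : L → Finset V := fun u =>
    (B u).filter fun v => ∀ x ∈ C, 2 * N * #((W x).filter (G.Adj v)) < D with hlowdef
  have hlow2 : ∀ u ∈ K, S ≤ 2 * #(low u) := by
    intro u hu
    have f1 : B u ⊆ low u ∪ C.biUnion fun x =>
        (B u).filter fun v => D ≤ 2 * N * #((W x).filter (G.Adj v)) := by
      intro v hv
      by_cases h : ∀ x ∈ C, 2 * N * #((W x).filter (G.Adj v)) < D
      · exact mem_union_left _ (mem_filter.2 ⟨hv, h⟩)
      · push Not at h
        obtain ⟨x, hx, h⟩ := h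
        exact mem_union_right _ (mem_biUnion.2 ⟨x, hx, mem_filter.2 ⟨hv, h⟩⟩)
    have f2 := ((card_le_card f1).trans (card_union_le _ _)).trans
      (Nat.add_le_add_left card_biUnion_le _)
    rw [hB] at f2
    have f3 : 2 * N * ∑ x ∈ C, #((B u).filter fun v => D ≤ 2 * N * #((W x).filter (G.Adj v))) ≤
        N * S := by
      rw [mul_sum]
      calc _ ≤ ∑ x ∈ C, S := sum_le_sum fun x hx => (hlow u hu x hx).le
        _ ≤ N * S := by
          rw [sum_const, smul_eq_mul]
          exact Nat.mul_le_mul_right _ (hN _)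
    have f4 : 2 * ∑ x ∈ C, #((B u).filter fun v => D ≤ 2 * N * #((W x).filter (G.Adj v))) ≤ S :=
      Nat.le_of_mul_le_mul_left (by rwa [← mul_assoc, mul_comm N 2]) hN1
    omega
  obtain ⟨f, hf, hadj⟩ := hst (Zy y) (τ y) hpres (fun z => if z = y then P else low z)
    (fun z _ => by
      split_ifs with h
      · rw [h]; exact filter_subset _ _
      · exact filter_subset _ _)
    (fun z hz => by
      split_ifs with h
      · exact hP.trans (Nat.mul_le_mul_right _ (by omega))
      · refine (hlow2 z ((mem_insert.1 (hZK hz)).resolve_left h)).trans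
          (Nat.mul_le_mul_right _ (by omega)))
  dsimp only at hf
  have hfB : ∀ i ∈ Zy y, f i ∈ B i := by
    intro i hi
    have := hf i hi
    split_ifs at this with h
    · subst h; exact (mem_filter.1 this).1
    · exact (mem_filter.1 this).1
  have hr : D ≤ #((W x₀).filter (G.Adj (f y))) := by
    have := hf y hyZ
    rw [if_pos rfl] at this
    exact (mem_filter.1 this).2
  -- New vertices are collected where the root has most neighbours, `a` of them. Then each `W x`
  -- loses at most `a + a / 2`, while at least `a / 2` vertices are gained and `s` rises by `a`.
  obtain ⟨x₁, hx₁, hmax⟩ := C.exists_max_image (fun x => #((W x).filter (G.Adj (f y)))) ⟨x₀, hx₀⟩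
  set a := #((W x₁).filter (G.Adj (f y))) with ha
  have haD : D ≤ a := hr.trans (hmax x₀ hx₀)
  -- neighbours of the non-root vertices of the copy
  set O : L → Finset V := fun x =>
    ((Zy y).erase y).biUnion fun i => (W x).filter (G.Adj (f i)) with hO
  have hOc : ∀ x ∈ C, 2 * #(O x) ≤ a := by
    intro x hx
    have f1 : 2 * N * #(O x) ≤ N * D := by
      calc 2 * N * #(O x) ≤ 2 * N * ∑ i ∈ (Zy y).erase y, #((W x).filter (G.Adj (f i))) :=
            Nat.mul_le_mul_left _ card_biUnion_le
        _ = ∑ i ∈ (Zy y).erase y, 2 * N * #((W x).filter (G.Adj (f i))) := mul_sum _ _ _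
        _ ≤ ∑ i ∈ (Zy y).erase y, D := by
          refine sum_le_sum fun i hi => ?_
          have := hf i (mem_of_mem_erase hi)
          rw [if_neg (ne_of_mem_erase hi)] at this
          exact ((mem_filter.1 this).2 x hx).le
        _ ≤ N * D := by
          rw [sum_const, smul_eq_mul]
          exact Nat.mul_le_mul_right _ (hN _)
    exact (Nat.le_of_mul_le_mul_left (by rwa [← mul_assoc, mul_comm N 2]) hN1).trans haD
  set new := (W x₁).filter (G.Adj (f y)) \ O x₁ with hnew
  have hnewc : a ≤ 2 * #new := by
    have f1 := le_card_sdiff (O x₁) ((W x₁).filter (G.Adj (f y)))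
    have f2 := hOc x₁ hx₁
    rw [← hnew] at f1
    omega
  set W' : L → Finset V := fun x => W x \ ((W x).filter (G.Adj (f y)) ∪ O x) with hW'
  have hW'sub : ∀ x, W' x ⊆ W x := fun x => sdiff_subset
  have hfW' : ∀ i ∈ Zy y, ∀ x' ∈ C, ∀ w' ∈ W' x', ¬ G.Adj (f i) w' := by
    intro i hi x' _ w' hw' hcon
    rw [hW', mem_sdiff, mem_union, not_or] at hw'
    by_cases hiy : i = y
    · subst hiy
      exact hw'.2.1 (mem_filter.2 ⟨hw'.1, hcon⟩)
    · exact hw'.2.2 (mem_biUnion.2 ⟨i, mem_erase.2 ⟨hiy, hi⟩, mem_filter.2 ⟨hw'.1, hcon⟩⟩)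
  have hnewW : new ⊆ W x₁ := sdiff_subset.trans (filter_subset _ _)
  set Good' : L → L → Finset V := fun y' x =>
    if y' = y ∧ x = x₁ then Good y x₁ ∪ new else Good y' x with hGood'
  refine ⟨s + a, W', Good', by omega, Nat.add_le_add_left (hdeg _ _) _, ?_⟩
  constructor
  · exact fun x hx => (hW'sub x).trans (hstate.rest_subset x hx)
  · intro x hx
    have f1 := hstate.le_rest x hx
    have f2 := le_card_sdiff ((W x).filter (G.Adj (f y)) ∪ O x) (W x)
    have f3 := card_union_le ((W x).filter (G.Adj (f y))) (O x)
    have f4 := hOc x hx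
    have f5 := hmax x hx
    simp only [hW']
    omega
  · intro y' hy' x hx
    simp only [hGood']
    split_ifs with h
    · rw [h.2]
      exact union_subset (hstate.good_subset y hy x₁ hx₁)
        (hnewW.trans (hstate.rest_subset x₁ hx₁))
    · exact hstate.good_subset y' hy' x hx
  · intro y' hy' x hx
    simp only [hGood']
    split_ifs with h
    · rw [h.2]
      refine disjoint_union_left.2
        ⟨disjoint_of_subset_right (hW'sub _) (hstate.disj y hy x₁ hx₁), ?_⟩
      rw [disjoint_left]
      intro w hw hw'
      exact (mem_sdiff.1 hw').2 (mem_union_left _ (mem_sdiff.1 hw).1)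
    · exact disjoint_of_subset_right (hW'sub _) (hstate.disj y' hy' x hx)
  · intro y' hy' x hx w hw
    have hold : w ∈ Good y' x → ∃ f, IsCopy G B (Zy y') (τ y') f ∧
        (∀ i ∈ Zy y', G.Adj (f i) w ↔ i = y') ∧
        ∀ i ∈ Zy y', ∀ x' ∈ C, ∀ w' ∈ W' x', ¬ G.Adj (f i) w' := fun h => by
      obtain ⟨g, h1, h2, h3⟩ := hstate.good y' hy' x hx w h
      exact ⟨g, h1, h2, fun i hi x' hx' w' hw' => h3 i hi x' hx' w' (hW'sub x' hw')⟩
    simp only [hGood'] at hw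
    split_ifs at hw with h
    · obtain ⟨rfl, rfl⟩ := h
      rcases mem_union.1 hw with hw | hw
      · exact hold hw
      · rw [hnew, mem_sdiff, mem_filter] at hw
        refine ⟨f, ⟨hfB, hadj⟩, fun i hi => ⟨fun h => ?_, fun h => h ▸ hw.1.2⟩, hfW'⟩
        by_contra hiy
        exact hw.2 (mem_biUnion.2 ⟨i, mem_erase.2 ⟨hiy, hi⟩, mem_filter.2 ⟨hw.1.1, h⟩⟩)
    · exact hold hw
  · have f1 := hstate.le_good
    have f2 : ∑ y' ∈ Y, ∑ x ∈ C, #(Good' y' x) =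
        ∑ y' ∈ Y, ∑ x ∈ C, #(Good y' x) + #new := by
      have : ∀ y' ∈ Y, ∀ x ∈ C, #(Good' y' x) =
          #(Good y' x) + if y' = y then if x = x₁ then #new else 0 else 0 := by
        intro y' _ x _
        simp only [hGood']
        by_cases h1 : y' = y <;> by_cases h2 : x = x₁ <;> simp only [h1, h2, and_self, if_true,
          if_false, and_true, and_false, add_zero]
        refine card_union_of_disjoint ?_
        exact disjoint_of_subset_right hnewW (hstate.disj y hy x₁ hx₁)
      rw [sum_congr rfl fun y' hy' => sum_congr rfl (this y' hy')]
      simp only [sum_add_distrib]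
      congr 1
      rw [sum_eq_single_of_mem y hy (by simp +contextual)]
      simp [hx₁]
    omega

end Blocks

/-! ### The attach-or-link dichotomy -/

section Blocks

open scoped Classical

variable {V L : Type*} [DecidableEq L]

/-- At the critical threshold `D`, either a block of `K` has many vertices of degree at least `D /
(2N)`, which is the situation of `IsPresent.attach_leaf`, or none has and `D` is attained in a block
of `Y`, which is that of `LinkState.extend`. -/
theorem LinkState.step {G : SimpleGraph V} {B : L → Finset V} {E S N s : ℕ}
    (hdeg : ∀ v (X : Finset V), #(X.filter (G.Adj v)) ≤ E)
    (hedge : ∀ X X' : Finset V, Disjoint X X' → E ≤ #X → E ≤ #X' → ∃ a ∈ X, ∃ b ∈ X', G.Adj a b)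
    (hE : 1 ≤ E) (hN : ∀ X : Finset L, #X ≤ N) (hB : ∀ i, #(B i) = S)
    (hdisj : ∀ i j, i ≠ j → Disjoint (B i) (B j)) (hS : 1000 * N ^ 3 * E ≤ S)
    (hst : IsStable G B S (200 * N ^ 3)) {Y K C : Finset L}
    {Zy : L → Finset L} {τ : L → SimpleGraph L} {W : L → Finset V} {Good : L → L → Finset V}
    (hstate : LinkState G B S Y C Zy τ s W Good) (hY : Y.Nonempty) (hC : C.Nonempty)
    (hYC : Disjoint Y C) (hKC : Disjoint K C)
    (hZK : ∀ y ∈ Y, Zy y ⊆ insert y K) (hyZ : ∀ y ∈ Y, y ∈ Zy y)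
    (hpres : ∀ y ∈ Y, IsPresent G B (Zy y) (τ y)) (hs : 8 * s < S) :
    (∃ x ∈ C, ∃ u ∈ K, ∀ Z ⊆ Y ∪ K, u ∈ Z → ∀ σ σ' : SimpleGraph L, IsPresent G B Z σ →
      (∀ i ∈ Z, ∀ j ∈ Z, σ.Adj i j ↔ σ'.Adj i j) → (∀ i ∈ Z, σ'.Adj x i ↔ i = u) →
      IsPresent G B (insert x Z) σ') ∨
    ∃ s' W' Good', s < s' ∧ s' ≤ s + E ∧ LinkState G B S Y C Zy τ s' W' Good' := by
  obtain ⟨y₀, hy₀⟩ := hY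
  obtain ⟨x₀, hx₀⟩ := hC
  have hN1 : 1 ≤ N := (card_pos.2 ⟨y₀, hy₀⟩).trans_le (hN Y)
  have hN3 : 1 ≤ N ^ 3 := Nat.one_le_pow _ _ hN1
  have hSE : 1000 * E ≤ S := le_trans (Nat.mul_le_mul_right _ (by omega)) hS
  -- `Large 1` holds since large sets are joined by edges, and `Large (E + 1)` fails by the degree
  -- bound. So there is a last `D` at which it holds.
  let Large (D : ℕ) : Prop := ∃ z ∈ Y ∪ K, ∃ x ∈ C,
    S ≤ 2 * N * #((B z).filter fun v => D ≤ #((W x).filter (G.Adj v)))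
  have hL1 : Large 1 := by
    refine ⟨y₀, mem_union_left _ hy₀, x₀, hx₀, ?_⟩
    have f1 : #((B y₀).filter fun v => ¬ 1 ≤ #((W x₀).filter (G.Adj v))) < E := by
      by_contra! hcon
      have f0 := hstate.le_rest x₀ hx₀
      obtain ⟨a, ha, b, hb, hab⟩ := hedge _ (W x₀)
        (disjoint_of_subset_left (filter_subset _ _)
          (disjoint_of_subset_right (hstate.rest_subset x₀ hx₀)
            (hdisj y₀ x₀ fun h => disjoint_left.1 hYC hy₀ (h ▸ hx₀)))) hcon (by omega)
      exact absurd (mem_filter.1 ha).2 (not_lt.2 (card_pos.2 ⟨b, mem_filter.2 ⟨hb, hab⟩⟩))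
    have f2 := card_filter_add_card_filter_not (s := B y₀)
        (fun v => 1 ≤ #((W x₀).filter (G.Adj v)))
    rw [hB] at f2
    calc S ≤ 2 * #((B y₀).filter fun v => 1 ≤ #((W x₀).filter (G.Adj v))) := by omega
      _ ≤ _ := Nat.mul_le_mul_right _ (by omega)
  have hL2 : ¬ Large (E + 1) := by
    rintro ⟨z, -, x, -, h⟩
    rw [filter_false_of_mem fun v _ => by have := hdeg v (W x); omega] at h
    simp at h
    omega
  obtain ⟨D, hD1, hD, hD'⟩ : ∃ D, 1 ≤ D ∧ Large D ∧ ¬ Large (D + 1) := by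
    by_contra! hcon
    exact hL2 (Nat.le_induction hL1 (fun n hn h => hcon n hn h) (E + 1) (by omega))
  by_cases hcase : ∃ u ∈ K, ∃ x ∈ C,
      S ≤ 2 * N * #((B u).filter fun v => D ≤ 2 * N * #((W x).filter (G.Adj v)))
  · obtain ⟨u, hu, x, hx, hux⟩ := hcase
    refine Or.inl ⟨x, hx, u, hu, fun Z hZ huZ σ σ' hσ h1 h2 => ?_⟩
    refine hσ.attach_leaf hdeg hE hN hB hS hst (J := Y ∪ K) ?_ (hstate.rest_subset x hx) hD1 hux
      ?_ hZ huZ h1 h2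
    · rw [mem_union, not_or]
      exact ⟨fun h => disjoint_left.1 hYC h hx, fun h => disjoint_left.1 hKC h hx⟩
    · intro z hz
      by_contra! hcon
      exact hD' ⟨z, hz, x, hx, hcon⟩
  · push Not at hcase
    right
    obtain ⟨z, hz, x, hx, hzx⟩ := hD
    have hzY : z ∈ Y := by
      refine (mem_union.1 hz).resolve_right fun hzK => ?_
      refine absurd (hcase z hzK x hx) (not_lt.2 (hzx.trans (Nat.mul_le_mul_left _
        (card_le_card (monotone_filter_right _ fun v _ h => ?_)))))
      exact le_trans h (Nat.le_mul_of_pos_left _ (by omega))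
    exact hstate.extend hdeg hN hB hst hzY hx (hZK z hzY) (hyZ z hzY) (hpres z hzY) hD1 hzx hcase

/-- The dichotomy behind the construction of trees. Let every `y ∈ Y` be the root of a pattern
present on a subset of `insert y K`. Either some `x ∈ C` can be attached as a leaf at some `u ∈ K`
to every pattern present on a subset of `Y ∪ K` containing `u`, or some of the rooted patterns can
be linked by a single edge `y x` to every pattern present on a subset of `C` containing `x`. -/
def AttachOrLink (G : SimpleGraph V) (B : L → Finset V) : Prop :=
  ∀ (Y K C : Finset L) (Zy : L → Finset L) (τ : L → SimpleGraph L), Y.Nonempty → C.Nonempty →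
    Disjoint Y C → Disjoint K C → (∀ y ∈ Y, Zy y ⊆ insert y K) → (∀ y ∈ Y, y ∈ Zy y) →
    (∀ y ∈ Y, IsPresent G B (Zy y) (τ y)) →
    (∃ x ∈ C, ∃ u ∈ K, ∀ Z ⊆ Y ∪ K, u ∈ Z → ∀ σ σ' : SimpleGraph L, IsPresent G B Z σ →
      (∀ i ∈ Z, ∀ j ∈ Z, σ.Adj i j ↔ σ'.Adj i j) → (∀ i ∈ Z, σ'.Adj x i ↔ i = u) →
      IsPresent G B (insert x Z) σ') ∨
    ∃ y ∈ Y, ∃ x ∈ C, ∀ Z ⊆ C, x ∈ Z → ∀ σ σ' : SimpleGraph L, IsPresent G B Z σ →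
      (∀ i ∈ Zy y, ∀ j ∈ Zy y, (τ y).Adj i j ↔ σ'.Adj i j) →
      (∀ i ∈ Z, ∀ j ∈ Z, σ.Adj i j ↔ σ'.Adj i j) →
      (∀ i ∈ Zy y, ∀ j ∈ Z, σ'.Adj i j ↔ i = y ∧ j = x) → IsPresent G B (Zy y ∪ Z) σ'

/-- If no leaf can be attached, states extend until `s` is about `S / 8`. Then some `Good y x` has
size at least `S / (16 N²)` by pigeonhole, and each `W x` still has size at least `S / 2`. A pattern
found with its vertex `x` in `Good y x` and the others in the sets `W` meets the copy stored for
that vertex in a single edge. -/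
theorem IsStable.attachOrLink {G : SimpleGraph V} {B : L → Finset V} {E S N : ℕ}
    (hst : IsStable G B S (200 * N ^ 3))
    (hdeg : ∀ v (X : Finset V), #(X.filter (G.Adj v)) ≤ E)
    (hedge : ∀ X X' : Finset V, Disjoint X X' → E ≤ #X → E ≤ #X' → ∃ a ∈ X, ∃ b ∈ X', G.Adj a b)
    (hE : 1 ≤ E) (hN : ∀ X : Finset L, #X ≤ N) (hB : ∀ i, #(B i) = S)
    (hdisj : ∀ i j, i ≠ j → Disjoint (B i) (B j)) (hS : 1000 * N ^ 3 * E ≤ S) :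
    AttachOrLink G B := by
  intro Y K C Zy τ hY hC hYC hKC hZK hyZ hpres
  rw [or_iff_not_imp_left]
  intro hno
  obtain ⟨y₀, hy₀⟩ := id hY
  have hN1 : 1 ≤ N := (card_pos.2 ⟨y₀, hy₀⟩).trans_le (hN Y)
  have hN23 : N ^ 2 ≤ N ^ 3 := Nat.pow_le_pow_right hN1 (by norm_num)
  have hN3 : 1 ≤ N ^ 3 := Nat.one_le_pow _ _ hN1
  have hSE : 1000 * E ≤ S := le_trans (Nat.mul_le_mul_right _ (by omega)) hS
  -- `n` bounds the number of extensions left, as `s` strictly increases. The last one overshoots `S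
  -- / 8` by at most `E`.
  have hloop : ∀ n s W Good, LinkState G B S Y C Zy τ s W Good → 8 * s ≤ S + 8 * E → S ≤ s + n →
      ∃ s W Good, LinkState G B S Y C Zy τ s W Good ∧ S ≤ 8 * s ∧ 8 * s ≤ S + 8 * E := by
    intro n
    induction n with
    | zero => exact fun s W Good h1 h2 h3 => ⟨s, W, Good, h1, by omega, h2⟩
    | succ n ih =>
      intro s W Good h1 h2 h3
      by_cases hs : 8 * s < S
      · obtain ⟨s', W', Good', h4, h5, h6⟩ := (h1.step hdeg hedge hE hN hB hdisj hS hst hY hC hYC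
          hKC hZK hyZ hpres hs).resolve_left hno
        exact ih s' W' Good' h6 (by omega) (by omega)
      · exact ⟨s, W, Good, h1, by omega, h2⟩
  obtain ⟨s, W, Good, hstate, hs1, hs2⟩ := hloop S 0 B (fun _ _ => ∅)
    ⟨fun _ _ => Subset.rfl, fun x _ => by rw [hB]; omega, by simp, by simp, by simp, by simp⟩
    (by omega) (by omega)
  obtain ⟨y, hy, x, hx, hyx⟩ : ∃ y ∈ Y, ∃ x ∈ C, S ≤ 16 * N ^ 2 * #(Good y x) := by
    by_contra! hcon
    have f1 : 16 * N ^ 2 * ∑ y ∈ Y, ∑ x ∈ C, #(Good y x) < N ^ 2 * S := by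
      rw [mul_sum]
      simp_rw [mul_sum]
      calc _ < ∑ y ∈ Y, ∑ x ∈ C, S :=
            sum_lt_sum_of_nonempty hY fun y hy => sum_lt_sum_of_nonempty hC fun x hx =>
              hcon y hy x hx
        _ = #Y * #C * S := by simp [mul_assoc]
        _ ≤ N ^ 2 * S := by
          rw [pow_two]
          exact Nat.mul_le_mul_right _ (Nat.mul_le_mul (hN _) (hN _))
    have f2 := hstate.le_good
    have f3 : N ^ 2 * (16 * ∑ y ∈ Y, ∑ x ∈ C, #(Good y x)) < N ^ 2 * S := by
      rwa [← mul_assoc, mul_comm (N ^ 2) 16]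
    have f4 := Nat.lt_of_mul_lt_mul_left f3
    omega
  refine ⟨y, hy, x, hx, fun Z hZ hxZ σ σ' hσ h1 h2 h3 => ?_⟩
  obtain ⟨g, hg, hgadj⟩ := hst Z σ hσ (fun x' => if x' = x then Good y x else W x')
    (fun i hi => by
      split_ifs with h
      · rw [h]; exact hstate.good_subset y hy x hx
      · exact hstate.rest_subset i (hZ hi))
    (fun i hi => by
      split_ifs with h
      · exact hyx.trans (Nat.mul_le_mul_right _ (by omega))
      · have := hstate.le_rest i (hZ hi)
        calc S ≤ 2 * #(W i) := by omega
          _ ≤ _ := Nat.mul_le_mul_right _ (by omega))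
  dsimp only at hg
  have hgx := hg x hxZ
  rw [if_pos rfl] at hgx
  obtain ⟨f, ⟨hfB, hfadj⟩, hfx, hfW⟩ := hstate.good y hy x hx _ hgx
  have hfg : ∀ i ∈ Zy y, ∀ j ∈ Z, G.Adj (f i) (g j) ↔ σ'.Adj i j := by
    intro i hi j hj
    rw [h3 i hi j hj]
    by_cases hjx : j = x
    · subst hjx
      rw [hfx i hi]
      simp
    · have := hg j hj
      rw [if_neg hjx] at this
      simp [hjx, hfW i hi j (hZ hj) _ this]
  have hZZ : ∀ i ∈ Z, i ∉ Zy y := by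
    intro i hi hiy
    rcases mem_insert.1 (hZK y hy hiy) with rfl | hiK
    · exact disjoint_left.1 hYC hy (hZ hi)
    · exact disjoint_left.1 hKC hiK (hZ hi)
  refine ⟨fun i => if i ∈ Zy y then f i else g i, fun i hi => ?_, fun i hi j hj => ?_⟩
  · dsimp only
    rcases mem_union.1 hi with hi | hi
    · rw [if_pos hi]; exact hfB i hi
    · rw [if_neg (hZZ i hi)]
      have := hg i hi
      split_ifs at this with h
      · subst h; exact hstate.good_subset y hy i hx this
      · exact hstate.rest_subset i (hZ hi) this
  · dsimp only
    rcases mem_union.1 hi with hi | hi <;> rcases mem_union.1 hj with hj | hj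
    · rw [if_pos hi, if_pos hj, hfadj i hi j hj, h1 i hi j hj]
    · rw [if_pos hi, if_neg (hZZ j hj), hfg i hi j hj]
    · rw [if_pos hj, if_neg (hZZ i hi), G.adj_comm, σ'.adj_comm, hfg j hj i hi]
    · rw [if_neg (hZZ i hi), if_neg (hZZ j hj), hgadj i hi j hj, h2 i hi j hj]

end Blocks

/-! ### Trees given by parent functions -/

section ParentTrees

variable {L : Type*}

/-- Adjacency in the tree on `ℕ` with root `0` and parent function `p`. -/
def ParentAdj (p : ℕ → ℕ) (i j : ℕ) : Prop := (0 < i ∧ p i = j) ∨ (0 < j ∧ p j = i)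

/-- `φ` is an induced embedding into `τ` of the first `s` vertices of the tree with parent
function `p`. -/
def IsParentEmb (p : ℕ → ℕ) (τ : SimpleGraph L) (s : ℕ) (φ : ℕ → L) : Prop :=
  (∀ i < s, ∀ j < s, φ i = φ j → i = j) ∧
    ∀ i < s, ∀ j < s, τ.Adj (φ i) (φ j) ↔ ParentAdj p i j

theorem IsParentEmb.extend {p : ℕ → ℕ} (hp : ∀ i, 0 < i → p i < i) {τ τ' : SimpleGraph L} {s : ℕ}
    (hs : 0 < s) {φ : ℕ → L} (h : IsParentEmb p τ s φ)
    (hτ : ∀ i < s, ∀ j < s, τ.Adj (φ i) (φ j) ↔ τ'.Adj (φ i) (φ j)) {l : L}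
    (hl : ∀ i < s, φ i ≠ l) (hadj : ∀ i < s, τ'.Adj l (φ i) ↔ φ i = φ (p s)) :
    IsParentEmb p τ' (s + 1) (Function.update φ s l) := by
  have h0 : ∀ i < s, Function.update φ s l i = φ i := fun i hi =>
    Function.update_of_ne hi.ne _ _
  have h1 : Function.update φ s l s = l := Function.update_self _ _ _
  have h2 : ∀ i < s, τ'.Adj l (φ i) ↔ ParentAdj p s i := by
    intro i hi
    rw [hadj i hi]
    have : p i < i ∨ i = 0 := by
      rcases Nat.eq_zero_or_pos i with h | h
      · exact Or.inr h
      · exact Or.inl (hp i h)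
    constructor
    · exact fun h3 => Or.inl ⟨hs, (h.1 i hi _ (hp s hs) h3).symm⟩
    · rintro (⟨-, rfl⟩ | ⟨h3, h4⟩)
      · rfl
      · omega
  constructor
  · intro i hi j hj hij
    rcases Nat.lt_succ_iff_lt_or_eq.1 hi with hi' | rfl <;>
      rcases Nat.lt_succ_iff_lt_or_eq.1 hj with hj' | rfl
    · rw [h0 i hi', h0 j hj'] at hij
      exact h.1 i hi' j hj' hij
    · rw [h0 i hi', h1] at hij
      exact absurd hij (hl i hi')
    · rw [h0 j hj', h1] at hij
      exact absurd hij.symm (hl j hj')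
    · rfl
  · intro i hi j hj
    rcases Nat.lt_succ_iff_lt_or_eq.1 hi with hi' | rfl <;>
      rcases Nat.lt_succ_iff_lt_or_eq.1 hj with hj' | rfl
    · rw [h0 i hi', h0 j hj', ← hτ i hi' j hj']
      exact h.2 i hi' j hj'
    · rw [h0 i hi', h1, τ'.adj_comm, h2 i hi', ParentAdj, ParentAdj, or_comm]
    · rw [h0 j hj', h1, h2 j hj']
    · have := hp _ hs
      simp only [SimpleGraph.irrefl, ParentAdj, false_iff]
      omega

/-- Two graphs on disjoint sets can be linked by one edge. -/
theorem exists_link {Z₁ Z₂ : Finset L} (hd : Disjoint Z₁ Z₂) (τ₁ τ₂ : SimpleGraph L) {y x : L}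
    (hy : y ∈ Z₁) (hx : x ∈ Z₂) : ∃ τ : SimpleGraph L,
      (∀ i ∈ Z₁, ∀ j ∈ Z₁, τ₁.Adj i j ↔ τ.Adj i j) ∧
      (∀ i ∈ Z₂, ∀ j ∈ Z₂, τ₂.Adj i j ↔ τ.Adj i j) ∧
      ∀ i ∈ Z₁, ∀ j ∈ Z₂, τ.Adj i j ↔ i = y ∧ j = x := by
  have hne : ∀ i ∈ Z₁, ∀ j ∈ Z₂, i ≠ j := fun i hi j hj h => disjoint_left.1 hd hi (h ▸ hj)
  have hn1 : ∀ i ∈ Z₁, i ∉ Z₂ := fun i hi => disjoint_left.1 hd hi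
  have hn2 : ∀ i ∈ Z₂, i ∉ Z₁ := fun i hi => disjoint_right.1 hd hi
  let τ : SimpleGraph L :=
    { Adj := fun i j => (i ∈ Z₁ ∧ j ∈ Z₁ ∧ τ₁.Adj i j) ∨ (i ∈ Z₂ ∧ j ∈ Z₂ ∧ τ₂.Adj i j) ∨
        (i = y ∧ j = x) ∨ (i = x ∧ j = y)
      symm := ⟨fun i j h => by
        rcases h with ⟨h1, h2, h3⟩ | ⟨h1, h2, h3⟩ | ⟨h1, h2⟩ | ⟨h1, h2⟩
        · exact Or.inl ⟨h2, h1, h3.symm⟩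
        · exact Or.inr (Or.inl ⟨h2, h1, h3.symm⟩)
        · exact Or.inr (Or.inr (Or.inr ⟨h2, h1⟩))
        · exact Or.inr (Or.inr (Or.inl ⟨h2, h1⟩))⟩
      loopless := ⟨fun i h => by
        rcases h with ⟨h1, h2, h3⟩ | ⟨h1, h2, h3⟩ | ⟨h1, h2⟩ | ⟨h1, h2⟩
        · exact h3.ne rfl
        · exact h3.ne rfl
        · exact hne y hy x hx (h1.symm.trans h2)
        · exact hne y hy x hx (h2.symm.trans h1)⟩ }
  refine ⟨τ, fun i hi j hj => ?_, fun i hi j hj => ?_, fun i hi j hj => ?_⟩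
  · have := hne i hi x hx
    have := hne j hj x hx
    simp [τ, hn1 i hi, *]
  · have := (hne y hy i hi).symm
    have := (hne y hy j hj).symm
    simp [τ, hn2 i hi, *]
  · have := hne i hi x hx
    simp [τ, hn1 i hi, hn2 j hj, *]

end ParentTrees

/-! ### Binomial trees -/

section BinomialTrees

variable {L : Type*} [DecidableEq L]

/-- `τ` induces on `Z` a binomial tree of order `k` with root `r`. -/
def IsBinomial (τ : SimpleGraph L) : ℕ → Finset L → L → Prop
  | 0, Z, r => Z = {r}
  | k + 1, Z, r => ∃ Z₁ Z₂ r₂, Disjoint Z₁ Z₂ ∧ Z = Z₁ ∪ Z₂ ∧ IsBinomial τ k Z₁ r ∧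
      IsBinomial τ k Z₂ r₂ ∧ ∀ a ∈ Z₁, ∀ b ∈ Z₂, τ.Adj a b ↔ a = r ∧ b = r₂

theorem IsBinomial.root_mem {τ : SimpleGraph L} {k : ℕ} :
    ∀ {Z : Finset L} {r : L}, IsBinomial τ k Z r → r ∈ Z := by
  induction k with
  | zero => intro Z r h; simp [show Z = {r} from h]
  | succ k ih =>
    rintro Z r ⟨Z₁, Z₂, r₂, -, rfl, h, -⟩
    exact mem_union_left _ (ih h)

theorem IsBinomial.card_eq {τ : SimpleGraph L} {k : ℕ} :
    ∀ {Z : Finset L} {r : L}, IsBinomial τ k Z r → #Z = 2 ^ k := by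
  induction k with
  | zero => intro Z r h; simp [show Z = {r} from h]
  | succ k ih =>
    rintro Z r ⟨Z₁, Z₂, r₂, hd, rfl, h₁, h₂, -⟩
    rw [card_union_of_disjoint hd, ih h₁, ih h₂]
    ring

theorem IsBinomial.congr {τ τ' : SimpleGraph L} {k : ℕ} :
    ∀ {Z : Finset L} {r : L}, IsBinomial τ k Z r →
      (∀ i ∈ Z, ∀ j ∈ Z, τ.Adj i j ↔ τ'.Adj i j) → IsBinomial τ' k Z r := by
  induction k with
  | zero => exact fun h _ => h
  | succ k ih =>
    rintro Z r ⟨Z₁, Z₂, r₂, hd, rfl, h₁, h₂, hadj⟩ hτ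
    refine ⟨Z₁, Z₂, r₂, hd, rfl,
      ih h₁ fun i hi j hj => hτ i (mem_union_left _ hi) j (mem_union_left _ hj),
      ih h₂ fun i hi j hj => hτ i (mem_union_right _ hi) j (mem_union_right _ hj),
      fun a ha b hb => ?_⟩
    rw [← hτ a (mem_union_left _ ha) b (mem_union_right _ hb), hadj a ha b hb]

theorem IsBinomial.exists_subset {τ : SimpleGraph L} {j k : ℕ} (hjk : j ≤ k) :
    ∀ {Z : Finset L} {r : L}, IsBinomial τ k Z r → ∃ Z' ⊆ Z, IsBinomial τ j Z' r := by
  induction k, hjk using Nat.le_induction with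
  | base => exact fun h => ⟨_, Subset.rfl, h⟩
  | succ k _ ih =>
    rintro Z r ⟨Z₁, Z₂, r₂, -, rfl, h, -⟩
    obtain ⟨Z', hZ', h'⟩ := ih h
    exact ⟨Z', hZ'.trans subset_union_left, h'⟩

/-- A binomial tree contains one of the previous order all of whose vertices have a private leaf. -/
theorem IsBinomial.exists_leaves {τ : SimpleGraph L} {k : ℕ} :
    ∀ {Z : Finset L} {r : L}, IsBinomial τ (k + 1) Z r →
      ∃ Z' ⊆ Z, IsBinomial τ k Z' r ∧
        ∀ v ∈ Z', ∃ l ∈ Z, l ∉ Z' ∧ ∀ u ∈ Z', τ.Adj l u ↔ u = v := by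
  induction k with
  | zero =>
    rintro Z r ⟨Z₁, Z₂, r₂, hd, rfl, h₁, h₂, hadj⟩
    have h₁' : Z₁ = {r} := h₁
    have h₂' : Z₂ = {r₂} := h₂
    subst h₁' h₂'
    refine ⟨{r}, subset_union_left, rfl, fun v hv => ⟨r₂, by simp, ?_, fun u hu => ?_⟩⟩
    · exact fun h => disjoint_left.1 hd h (by simp)
    · rw [mem_singleton] at hu hv
      subst hu hv
      rw [τ.adj_comm, hadj _ (by simp) _ (by simp)]
      simp
  | succ k ih =>
    rintro Z r ⟨Z₁, Z₂, r₂, hd, rfl, h₁, h₂, hadj⟩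
    obtain ⟨Z₁', hs₁, hb₁, hl₁⟩ := ih h₁
    obtain ⟨Z₂', hs₂, hb₂, hl₂⟩ := ih h₂
    have hr₁ := hb₁.root_mem
    have hr₂ := hb₂.root_mem
    refine ⟨Z₁' ∪ Z₂', union_subset_union hs₁ hs₂, ⟨Z₁', Z₂', r₂,
      disjoint_of_subset_left hs₁ (disjoint_of_subset_right hs₂ hd), rfl, hb₁, hb₂,
      fun a ha b hb => hadj a (hs₁ ha) b (hs₂ hb)⟩, fun v hv => ?_⟩
    rcases mem_union.1 hv with hv | hv
    · obtain ⟨l, hl, hl', hlu⟩ := hl₁ v hv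
      refine ⟨l, mem_union_left _ hl, ?_, fun u hu => ?_⟩
      · rw [mem_union, not_or]
        exact ⟨hl', fun h => disjoint_left.1 hd hl (hs₂ h)⟩
      · rcases mem_union.1 hu with hu | hu
        · exact hlu u hu
        · rw [hadj l hl u (hs₂ hu)]
          refine ⟨fun h => absurd hr₁ (h.1 ▸ hl'), fun h => ?_⟩
          subst h
          exact absurd (hs₂ hu) (disjoint_left.1 hd (hs₁ hv))
    · obtain ⟨l, hl, hl', hlu⟩ := hl₂ v hv
      refine ⟨l, mem_union_right _ hl, ?_, fun u hu => ?_⟩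
      · rw [mem_union, not_or]
        exact ⟨fun h => disjoint_left.1 hd (hs₁ h) hl, hl'⟩
      · rcases mem_union.1 hu with hu | hu
        · rw [τ.adj_comm, hadj u (hs₁ hu) l hl]
          refine ⟨fun h => absurd hr₂ (h.2 ▸ hl'), fun h => ?_⟩
          subst h
          exact absurd (hs₂ hv) (disjoint_left.1 hd (hs₁ hu))
        · exact hlu u hu

/-- A binomial tree of order `k` contains every tree with `k + 1` vertices. -/
theorem IsBinomial.exists_isParentEmb {p : ℕ → ℕ} (hp : ∀ i, 0 < i → p i < i)
    {τ : SimpleGraph L} {k : ℕ} : ∀ {Z : Finset L} {r : L}, IsBinomial τ k Z r →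
      ∃ φ : ℕ → L, (∀ i < k + 1, φ i ∈ Z) ∧ IsParentEmb p τ (k + 1) φ := by
  induction k with
  | zero =>
    intro Z r h
    refine ⟨fun _ => r, fun _ _ => h.root_mem, fun i hi j hj _ => by omega, fun i hi j hj => ?_⟩
    simp only [SimpleGraph.irrefl, ParentAdj, false_iff]
    omega
  | succ k ih =>
    intro Z r h
    obtain ⟨Z', hZ', hb, hl⟩ := h.exists_leaves
    obtain ⟨φ, hφ, hemb⟩ := ih hb
    -- The next vertex goes to the private leaf of the image of its parent.
    obtain ⟨l, hlZ, hlZ', hlu⟩ := hl (φ (p (k + 1))) (hφ _ (hp _ (by omega)))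
    refine ⟨Function.update φ (k + 1) l, fun i hi => ?_, hemb.extend hp (by omega)
      (fun _ _ _ _ => Iff.rfl) (fun i hi h => hlZ' (h ▸ hφ i hi)) fun i hi => hlu _ (hφ i hi)⟩
    rcases Nat.lt_succ_iff_lt_or_eq.1 hi with hi' | rfl
    · rw [Function.update_of_ne hi'.ne]
      exact hZ' (hφ i hi')
    · rwa [Function.update_self]

end BinomialTrees

/-! ### Growing trees in a homogeneous index set -/

section Progress

variable {V L : Type*} [LinearOrder L] {G : SimpleGraph V} {B : L → Finset V}

/-- Some pattern present on `Z` is a binomial tree of order `k` with root `r`. -/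
def IsRooted (G : SimpleGraph V) (B : L → Finset V) (k : ℕ) (Z : Finset L) (r : L) : Prop :=
  ∃ τ, IsPresent G B Z τ ∧ IsBinomial τ k Z r

/-- Some pattern present on `Z` is a binomial tree whose root is the largest element. -/
def HasTop (G : SimpleGraph V) (B : L → Finset V) (k : ℕ) (Z : Finset L) : Prop :=
  ∃ r, (∀ z ∈ Z, z ≤ r) ∧ IsRooted G B k Z r

/-- Some pattern present on `Z` is a binomial tree whose root is the smallest element. -/
def HasBot (G : SimpleGraph V) (B : L → Finset V) (k : ℕ) (Z : Finset L) : Prop :=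
  ∃ r, (∀ z ∈ Z, r ≤ z) ∧ IsRooted G B k Z r

/-- Some pattern present on `Z` is the tree formed by the first `s` vertices of the tree with
parent function `p`, and the parent of the next vertex is at position `j` in `Z`. -/
def HasParentTree (G : SimpleGraph V) (B : L → Finset V) (p : ℕ → ℕ) (s j : ℕ) (Z : Finset L) :
    Prop :=
  ∃ τ φ, IsPresent G B Z τ ∧ IsParentEmb p τ s φ ∧ (range s).image φ = Z ∧
    #(Z.filter (· < φ (p s))) = j

/-- The presence of the trees of interest on subsets of `H` depends only on the cardinality. -/
structure IsHomogeneous (G : SimpleGraph V) (B : L → Finset V) (p : ℕ → ℕ) (m : ℕ)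
    (H : Finset L) : Prop where
  top : ∀ A ⊆ H, ∀ A' ⊆ H, ∀ k ≤ m, #A = 2 ^ k → #A' = 2 ^ k → HasTop G B k A → HasTop G B k A'
  bot : ∀ A ⊆ H, ∀ A' ⊆ H, ∀ k ≤ m, #A = 2 ^ k → #A' = 2 ^ k → HasBot G B k A → HasBot G B k A'
  tree : ∀ A ⊆ H, ∀ A' ⊆ H, ∀ s ≤ m, #A = s → #A' = s → ∀ j ≤ m,
    HasParentTree G B p s j A → HasParentTree G B p s j A'

theorem IsRooted.root_mem {k : ℕ} {Z : Finset L} {r : L} (h : IsRooted G B k Z r) : r ∈ Z := by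
  obtain ⟨τ, -, h⟩ := h
  exact h.root_mem

theorem IsRooted.card_eq {k : ℕ} {Z : Finset L} {r : L} (h : IsRooted G B k Z r) :
    #Z = 2 ^ k := by
  obtain ⟨τ, -, h⟩ := h
  exact h.card_eq

theorem IsHomogeneous.forall_hasTop {p : ℕ → ℕ} {m k : ℕ} {H Z : Finset L} {r : L}
    (hH : IsHomogeneous G B p m H) (hk : k ≤ m) (hZ : Z ⊆ H) (hr : IsRooted G B k Z r)
    (h : ∀ z ∈ Z, z ≤ r) : ∀ Z' ⊆ H, #Z' = 2 ^ k → HasTop G B k Z' :=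
  fun Z' hZ' hc => hH.top Z hZ Z' hZ' k hk hr.card_eq hc ⟨r, h, hr⟩

theorem IsHomogeneous.forall_hasBot {p : ℕ → ℕ} {m k : ℕ} {H Z : Finset L} {r : L}
    (hH : IsHomogeneous G B p m H) (hk : k ≤ m) (hZ : Z ⊆ H) (hr : IsRooted G B k Z r)
    (h : ∀ z ∈ Z, r ≤ z) : ∀ Z' ⊆ H, #Z' = 2 ^ k → HasBot G B k Z' :=
  fun Z' hZ' hc => hH.bot Z hZ Z' hZ' k hk hr.card_eq hc ⟨r, h, hr⟩

/-- Only `y` can be the largest element of a set formed by `y` and elements below it. This lets the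
root be prescribed. -/
theorem exists_isRooted_of_forall_hasTop {k : ℕ} {H A : Finset L} {y : L}
    (h : ∀ Z ⊆ H, #Z = 2 ^ k → HasTop G B k Z) (hy : y ∈ H) (hA : A ⊆ H) (hAy : ∀ z ∈ A, z < y)
    (hc : 2 ^ k ≤ #A + 1) : ∃ Z ⊆ insert y A, IsRooted G B k Z y := by
  have hk : 1 ≤ 2 ^ k := Nat.one_le_two_pow
  obtain ⟨A', hA', hc'⟩ := exists_subset_card_eq (s := A) (n := 2 ^ k - 1) (by omega)
  have hyA : y ∉ A' := fun hyA => lt_irrefl _ (hAy y (hA' hyA))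
  obtain ⟨r, hr, hroot⟩ := h (insert y A') (insert_subset hy (hA'.trans hA))
    (by rw [card_insert_of_notMem hyA]; omega)
  refine ⟨_, insert_subset_insert y hA', ?_⟩
  rcases mem_insert.1 hroot.root_mem with rfl | hrA
  · exact hroot
  · exact absurd (hr y (mem_insert_self _ _)) (not_le.2 (hAy r (hA' hrA)))

theorem exists_isRooted_of_forall_hasBot {k : ℕ} {H A : Finset L} {y : L}
    (h : ∀ Z ⊆ H, #Z = 2 ^ k → HasBot G B k Z) (hy : y ∈ H) (hA : A ⊆ H) (hAy : ∀ z ∈ A, y < z)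
    (hc : 2 ^ k ≤ #A + 1) : ∃ Z ⊆ insert y A, IsRooted G B k Z y := by
  have hk : 1 ≤ 2 ^ k := Nat.one_le_two_pow
  obtain ⟨A', hA', hc'⟩ := exists_subset_card_eq (s := A) (n := 2 ^ k - 1) (by omega)
  have hyA : y ∉ A' := fun hyA => lt_irrefl _ (hAy y (hA' hyA))
  obtain ⟨r, hr, hroot⟩ := h (insert y A') (insert_subset hy (hA'.trans hA))
    (by rw [card_insert_of_notMem hyA]; omega)
  refine ⟨_, insert_subset_insert y hA', ?_⟩
  rcases mem_insert.1 hroot.root_mem with rfl | hrA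
  · exact hroot
  · exact absurd (hr y (mem_insert_self _ _)) (not_le.2 (hAy r (hA' hrA)))

/-- The tree at `y` is first trimmed to the order of the tree at `x`. Joining two binomial trees of
equal order by an edge between their roots is symmetric, so either end may be the new root. -/
theorem exists_isRooted_link {a c : ℕ} {Zy C Z : Finset L} {τ : SimpleGraph L} {y x : L}
    (hy : IsBinomial τ a Zy y)
    (hlink : ∀ Z ⊆ C, x ∈ Z → ∀ σ σ' : SimpleGraph L, IsPresent G B Z σ →
      (∀ i ∈ Zy, ∀ j ∈ Zy, τ.Adj i j ↔ σ'.Adj i j) →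
      (∀ i ∈ Z, ∀ j ∈ Z, σ.Adj i j ↔ σ'.Adj i j) →
      (∀ i ∈ Zy, ∀ j ∈ Z, σ'.Adj i j ↔ i = y ∧ j = x) → IsPresent G B (Zy ∪ Z) σ')
    (hd : Disjoint Zy C) (hZ : Z ⊆ C) (hroot : IsRooted G B c Z x) (hca : c ≤ a) :
    ∃ Z' ⊆ Zy, IsRooted G B (c + 1) (Z' ∪ Z) y ∧ IsRooted G B (c + 1) (Z' ∪ Z) x := by
  obtain ⟨σ, hσ, hbin⟩ := hroot
  obtain ⟨σ', h1, h2, h3⟩ := exists_link (disjoint_of_subset_right hZ hd) τ σ hy.root_mem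
    hbin.root_mem
  have hpres := hlink Z hZ hbin.root_mem σ σ' hσ h1 h2 h3
  obtain ⟨Z', hZ', hbin'⟩ := (hy.congr h1).exists_subset hca
  have hpres' : IsPresent G B (Z' ∪ Z) σ' :=
    hpres.mono (union_subset_union hZ' Subset.rfl) (fun _ _ => Subset.rfl) fun _ _ _ _ => Iff.rfl
  have hd' : Disjoint Z' Z := disjoint_of_subset_left hZ' (disjoint_of_subset_right hZ hd)
  refine ⟨Z', hZ', ⟨σ', hpres', Z', Z, x, hd', rfl, hbin', hbin.congr h2,
    fun i hi j hj => h3 i (hZ' hi) j hj⟩, ⟨σ', hpres', Z, Z', y, hd'.symm, union_comm _ _,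
    hbin.congr h2, hbin', fun i hi j hj => ?_⟩⟩
  rw [σ'.adj_comm, h3 j (hZ' hj) i hi, and_comm]

theorem exists_lt_split (n : ℕ) {H : Finset L} (hn : n ≤ #H) :
    ∃ A ⊆ H, ∃ A' ⊆ H, #A = n ∧ #A' = #H - n ∧ ∀ a ∈ A, ∀ b ∈ A', a < b := by
  induction n with
  | zero => exact ⟨∅, by simp, H, Subset.rfl, by simp, by simp, by simp⟩
  | succ n ih =>
    obtain ⟨A, hA, A', hA', hc, hc', hlt⟩ := ih (by omega)
    have hne : A'.Nonempty := card_pos.1 (by omega)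
    have hmin := A'.min'_mem hne
    refine ⟨insert (A'.min' hne) A, insert_subset (hA' hmin) hA, A'.erase (A'.min' hne),
      (erase_subset _ _).trans hA', ?_, ?_, ?_⟩
    · rw [card_insert_of_notMem fun h => lt_irrefl _ (hlt _ h _ hmin), hc]
    · rw [card_erase_of_mem hmin, hc']
      omega
    · intro a ha b hb
      rcases mem_insert.1 ha with rfl | ha
      · exact lt_of_le_of_ne (A'.min'_le b (mem_of_mem_erase hb)) (ne_of_mem_erase hb).symm
      · exact hlt a ha b (mem_of_mem_erase hb)

theorem eq_of_card_filter_lt_eq {Z : Finset L} {u v : L} (hu : u ∈ Z) (hv : v ∈ Z)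
    (h : #(Z.filter (· < u)) = #(Z.filter (· < v))) : u = v := by
  have key : ∀ u ∈ Z, ∀ v ∈ Z, u < v → #(Z.filter (· < u)) < #(Z.filter (· < v)) := by
    intro u hu v _ huv
    refine card_lt_card ⟨fun z hz => ?_, fun hle => ?_⟩
    · rw [mem_filter] at hz ⊢
      exact ⟨hz.1, hz.2.trans huv⟩
    · exact lt_irrefl _ (mem_filter.1 (hle (mem_filter.2 ⟨hu, huv⟩))).2
  rcases lt_trichotomy u v with h1 | h1 | h1
  · exact absurd h (key u hu v hv h1).ne
  · exact h1
  · exact absurd h (key v hv u hu h1).ne'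

/-- A leaf can be added to a tree that is present on a set in which `u` is at the right position. -/
theorem HasParentTree.attach {p : ℕ → ℕ} (hp : ∀ i, 0 < i → p i < i) {s : ℕ} (hs : 0 < s)
    {Z : Finset L} {u x : L} (h : HasParentTree G B p s #(Z.filter (· < u)) Z) (hu : u ∈ Z)
    (hx : x ∉ Z)
    (hattach : ∀ σ σ' : SimpleGraph L, IsPresent G B Z σ →
      (∀ i ∈ Z, ∀ j ∈ Z, σ.Adj i j ↔ σ'.Adj i j) → (∀ i ∈ Z, σ'.Adj x i ↔ i = u) →
      IsPresent G B (insert x Z) σ') :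
    ∃ j ≤ s, HasParentTree G B p (s + 1) j (insert x Z) := by
  obtain ⟨τ, φ, hpres, hemb, rfl, hcard⟩ := h
  have hφ : ∀ i < s, φ i ∈ (range s).image φ := fun i hi =>
    mem_image_of_mem _ (mem_range.2 hi)
  have hpu := eq_of_card_filter_lt_eq (hφ _ (hp s hs)) hu hcard
  obtain ⟨σ', h1, -, h3⟩ := exists_link (disjoint_singleton_right.2 hx) τ ⊥ hu
    (mem_singleton_self x)
  have h4 : ∀ i ∈ (range s).image φ, σ'.Adj x i ↔ i = u := by
    intro i hi
    rw [σ'.adj_comm, h3 i hi x (mem_singleton_self x)]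
    simp
  have hne : ∀ i < s, φ i ≠ x := fun i hi h => hx (h ▸ hφ i hi)
  have himg : (range (s + 1)).image (Function.update φ s x) = insert x ((range s).image φ) := by
    rw [range_add_one, image_insert, Function.update_self]
    congr 1
    refine image_congr fun i hi => ?_
    exact Function.update_of_ne (mem_range.1 hi).ne _ _
  have hmem : Function.update φ s x (p (s + 1)) ∈ insert x ((range s).image φ) := by
    rw [← himg]
    exact mem_image_of_mem _ (mem_range.2 (hp _ (by omega)))
  refine ⟨_, ?_, σ', Function.update φ s x, hattach τ σ' hpres h1 h4, hemb.extend hp hs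
    (fun i hi j hj => h1 _ (hφ i hi) _ (hφ j hj)) hne (fun i hi => ?_), himg, rfl⟩
  · have hlt : #((insert x ((range s).image φ)).filter
        (· < Function.update φ s x (p (s + 1)))) < #(insert x ((range s).image φ)) :=
      card_lt_card (filter_ssubset.2 ⟨_, hmem, lt_irrefl _⟩)
    have hle : #(insert x ((range s).image φ)) ≤ s + 1 := by
      rw [← himg]
      exact card_image_le.trans (card_range _).le
    omega
  · rw [h4 _ (hφ i hi), hpu]

theorem IsHomogeneous.exists_larger_tree {p : ℕ → ℕ} (hp : ∀ i, 0 < i → p i < i) {m : ℕ}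
    {H : Finset L} (hAL : AttachOrLink G B) (hH : IsHomogeneous G B p m H)
    (hHc : 2 * m + 4 * 2 ^ m ≤ #H) {a b s : ℕ} (ha : a < m) (hb : b < m) (hs : 0 < s) (hsm : s < m)
    (htop : ∀ k ≤ a, ∀ Z ⊆ H, #Z = 2 ^ k → HasTop G B k Z)
    (hbot : ∀ k ≤ b, ∀ Z ⊆ H, #Z = 2 ^ k → HasBot G B k Z)
    (htree : ∃ j, ∀ Z ⊆ H, #Z = s → HasParentTree G B p s j Z) :
    (∀ Z ⊆ H, #Z = 2 ^ (a + 1) → HasTop G B (a + 1) Z) ∨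
    (∀ Z ⊆ H, #Z = 2 ^ (b + 1) → HasBot G B (b + 1) Z) ∨
    ∃ j, ∀ Z ⊆ H, #Z = s + 1 → HasParentTree G B p (s + 1) j Z := by
  have hpow : ∀ k ≤ m, 2 ^ k ≤ 2 ^ m := fun k hk => Nat.pow_le_pow_right (by norm_num) hk
  -- The layout is `Y₁ < K₁ < C < K₂ < Y₂`. The `K`'s hold the non-root vertices of the binomial
  -- trees, the `Y`'s have room for the wanted tree on both sides of `u`, and `C` has `2 ^ m`
  -- elements on one side of any `x`.
  obtain ⟨Y₁, hY₁, R₁, hR₁, hY₁c, hR₁c, hlt₁⟩ := exists_lt_split m (H := H) (by omega)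
  obtain ⟨K₁, hK₁, R₂, hR₂, hK₁c, hR₂c, hlt₂⟩ := exists_lt_split (2 ^ m) (H := R₁) (by omega)
  obtain ⟨C, hC, R₃, hR₃, hCc, hR₃c, hlt₃⟩ := exists_lt_split (2 * 2 ^ m) (H := R₂) (by omega)
  obtain ⟨K₂, hK₂, Y₂, hY₂, hK₂c, hY₂c, hlt₄⟩ := exists_lt_split (2 ^ m) (H := R₃) (by omega)
  have hR₂H := hR₂.trans hR₁
  have hR₃H := hR₃.trans hR₂H
  have hK₁H := hK₁.trans hR₁
  have hCH := hC.trans hR₂H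
  have hK₂H := hK₂.trans hR₃H
  have hY₂H := hY₂.trans hR₃H
  have hY₁K₁ : ∀ y ∈ Y₁, ∀ z ∈ K₁, y < z := fun y hy z hz => hlt₁ y hy z (hK₁ hz)
  have hY₁C : ∀ y ∈ Y₁, ∀ z ∈ C, y < z := fun y hy z hz => hlt₁ y hy z (hR₂ (hC hz))
  have hK₁C : ∀ y ∈ K₁, ∀ z ∈ C, y < z := fun y hy z hz => hlt₂ y hy z (hC hz)
  have hCK₂ : ∀ y ∈ C, ∀ z ∈ K₂, y < z := fun y hy z hz => hlt₃ y hy z (hK₂ hz)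
  have hCY₂ : ∀ y ∈ C, ∀ z ∈ Y₂, y < z := fun y hy z hz => hlt₃ y hy z (hY₂ hz)
  have hY₁Y₂ : ∀ y ∈ Y₁, ∀ z ∈ Y₂, y < z := fun y hy z hz => hlt₁ y hy z (hR₂ (hR₃ (hY₂ hz)))
  have hdata : ∀ y, ∃ Z τ, (y ∈ Y₁ → Z ⊆ insert y K₁ ∧ IsPresent G B Z τ ∧ IsBinomial τ b Z y) ∧
      (y ∈ Y₂ → Z ⊆ insert y K₂ ∧ IsPresent G B Z τ ∧ IsBinomial τ a Z y) := by
    intro y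
    by_cases hy₁ : y ∈ Y₁
    · obtain ⟨Z, hZ, τ, h⟩ := exists_isRooted_of_forall_hasBot (hbot b le_rfl) (hY₁ hy₁) hK₁H
        (hY₁K₁ y hy₁) (by have := hpow b hb.le; omega)
      exact ⟨Z, τ, fun _ => ⟨hZ, h⟩, fun hy₂ => absurd (hY₁Y₂ y hy₁ y hy₂) (lt_irrefl _)⟩
    · by_cases hy₂ : y ∈ Y₂
      · obtain ⟨Z, hZ, τ, h⟩ := exists_isRooted_of_forall_hasTop (htop a le_rfl) (hY₂H hy₂) hK₂H
          (fun z hz => hlt₄ z hz y hy₂) (by have := hpow a ha.le; omega)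
        exact ⟨Z, τ, fun h => absurd h hy₁, fun _ => ⟨hZ, h⟩⟩
      · exact ⟨∅, ⊥, fun h => absurd h hy₁, fun h => absurd h hy₂⟩
  choose Zy τ hdata₁ hdata₂ using hdata
  have hCpos : C.Nonempty := card_pos.1 (by have := hpow 0 (by omega); omega)
  have hYC : Disjoint (Y₁ ∪ Y₂) C := by
    rw [disjoint_left]
    rintro z hz hzC
    rcases mem_union.1 hz with hz | hz
    · exact lt_irrefl _ (hY₁C z hz z hzC)
    · exact lt_irrefl _ (hCY₂ z hzC z hz)
  have hKC : Disjoint (K₁ ∪ K₂) C := by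
    rw [disjoint_left]
    rintro z hz hzC
    rcases mem_union.1 hz with hz | hz
    · exact lt_irrefl _ (hK₁C z hz z hzC)
    · exact lt_irrefl _ (hCK₂ z hzC z hz)
  have hZyK : ∀ y ∈ Y₁ ∪ Y₂, Zy y ⊆ insert y (K₁ ∪ K₂) := by
    intro y hy
    rcases mem_union.1 hy with hy | hy
    · exact (hdata₁ y hy).1.trans (insert_subset_insert _ subset_union_left)
    · exact (hdata₂ y hy).1.trans (insert_subset_insert _ subset_union_right)
  have hZyC : ∀ y ∈ Y₁ ∪ Y₂, Disjoint (Zy y) C := fun y hy =>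
    disjoint_of_subset_left (hZyK y hy) (disjoint_insert_left.2 ⟨disjoint_left.1 hYC hy, hKC⟩)
  rcases hAL (Y₁ ∪ Y₂) (K₁ ∪ K₂) C Zy τ
    ((card_pos.1 (by omega : 0 < #Y₁)).mono subset_union_left) hCpos hYC hKC hZyK
    (fun y hy => (mem_union.1 hy).elim (fun h => (hdata₁ y h).2.2.root_mem)
      fun h => (hdata₂ y h).2.2.root_mem)
    (fun y hy => (mem_union.1 hy).elim (fun h => (hdata₁ y h).2.1)
      fun h => (hdata₂ y h).2.1) with ⟨x, hx, u, hu, hatt⟩ | ⟨y, hy, x, hx, hlink⟩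
  · right; right
    obtain ⟨j, hj⟩ := htree
    have hjs : j < s := by
      obtain ⟨Z, hZ, hZc⟩ := exists_subset_card_eq (s := H) (n := s) (by omega)
      obtain ⟨σ, φ, -, -, himg, hcard⟩ := hj Z hZ hZc
      have hmem : φ (p s) ∈ Z := himg ▸ mem_image_of_mem _ (mem_range.2 (hp s hs))
      have hlt := card_lt_card (filter_ssubset (p := (· < φ (p s))).2 ⟨_, hmem, lt_irrefl _⟩)
      omega
    -- `u` must have rank `j` to be the parent of the next vertex: `j` elements are taken from `Y₁`,
    -- the rest from `Y₂`.
    obtain ⟨A, hA, hAc⟩ := exists_subset_card_eq (s := Y₁) (n := j) (by omega)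
    obtain ⟨A', hA', hAc'⟩ := exists_subset_card_eq (s := Y₂) (n := s - 1 - j) (by omega)
    have hAu : ∀ z ∈ A, z < u := by
      intro z hz
      rcases mem_union.1 hu with hu | hu
      · exact hY₁K₁ z (hA hz) u hu
      · exact (hY₁C z (hA hz) x hx).trans (hCK₂ x hx u hu)
    have huA' : ∀ z ∈ A', u < z := by
      intro z hz
      rcases mem_union.1 hu with hu | hu
      · exact (hK₁C u hu x hx).trans (hCY₂ x hx z (hA' hz))
      · exact hlt₄ u hu z (hA' hz)
    have huH : u ∈ H := (mem_union.1 hu).elim (fun h => hK₁H h) fun h => hK₂H h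
    set Z := A ∪ insert u A' with hZ
    have hZc : #Z = s := by
      rw [hZ, card_union_of_disjoint, card_insert_of_notMem fun h => lt_irrefl _ (huA' u h)]
      · omega
      · rw [disjoint_left]
        intro z hz hz'
        rcases mem_insert.1 hz' with rfl | hz'
        · exact lt_irrefl _ (hAu z hz)
        · exact lt_irrefl _ (hY₁Y₂ z (hA hz) z (hA' hz'))
    have hZf : Z.filter (· < u) = A := by
      ext z
      simp only [hZ, mem_filter, mem_union, mem_insert]
      constructor
      · rintro ⟨h | rfl | h, h2⟩
        · exact h
        · exact absurd h2 (lt_irrefl _)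
        · exact absurd h2 (huA' z h).not_gt
      · exact fun h => ⟨Or.inl h, hAu z h⟩
    have huZ : u ∈ Z := mem_union_right _ (mem_insert_self _ _)
    have hZH : Z ⊆ H := union_subset (hA.trans hY₁) (insert_subset huH (hA'.trans hY₂H))
    have hZYK : Z ⊆ Y₁ ∪ Y₂ ∪ (K₁ ∪ K₂) := union_subset
      ((hA.trans subset_union_left).trans subset_union_left)
      (insert_subset (mem_union_right _ hu) ((hA'.trans subset_union_right).trans
        subset_union_left))
    have hxZ : x ∉ Z := fun h => (mem_union.1 (hZYK h)).elim
      (fun h => disjoint_left.1 hYC h hx) fun h => disjoint_left.1 hKC h hx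
    have hjZ := hj Z hZH hZc
    rw [← hAc, ← hZf] at hjZ
    obtain ⟨j', hj', htree'⟩ := hjZ.attach hp hs huZ hxZ (hatt Z hZYK huZ)
    exact ⟨j', fun Z' hZ' hc => hH.tree _ (insert_subset (hCH hx) hZH) Z' hZ' (s + 1) (by omega)
      (by rw [card_insert_of_notMem hxZ, hZc]) hc j' (by omega) htree'⟩
  · have hxH := hCH hx
    have hbelow : C.filter (· < x) ⊆ H := (filter_subset _ _).trans hCH
    have habove : C.filter (x < ·) ⊆ H := (filter_subset _ _).trans hCH
    have hins : ∀ {q : L → Prop} [DecidablePred q], insert x (C.filter q) ⊆ C :=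
      fun {q} _ => insert_subset hx (filter_subset _ _)
    have hcount : 2 ^ m ≤ #(C.filter (· < x)) ∨ 2 ^ m ≤ #(C.filter (x < ·)) := by
      have h1 := card_filter_add_card_filter_not (s := C) (· < x)
      have h2 : C.filter (¬ · < x) = insert x (C.filter (x < ·)) := by
        ext z
        simp only [mem_filter, mem_insert, not_lt, le_iff_eq_or_lt]
        constructor
        · rintro ⟨h, rfl | h'⟩
          · exact Or.inl rfl
          · exact Or.inr ⟨h, h'⟩
        · rintro (rfl | ⟨h, h'⟩)
          · exact ⟨hx, Or.inl rfl⟩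
          · exact ⟨h, Or.inr h'⟩
      rw [h2, card_insert_of_notMem (by simp)] at h1
      omega
    have hclose : ∀ (k c : ℕ) (Z : Finset L), Z ⊆ C → IsBinomial (τ y) k (Zy y) y →
        IsRooted G B c Z x → c ≤ k → ∃ Z' ⊆ Zy y, Z' ∪ Z ⊆ H ∧
          IsRooted G B (c + 1) (Z' ∪ Z) y ∧ IsRooted G B (c + 1) (Z' ∪ Z) x := by
      intro k c Z hZ hbin hr hck
      obtain ⟨Z', hZ', h⟩ := exists_isRooted_link hbin hlink (hZyC y hy) hZ hr hck
      refine ⟨Z', hZ', union_subset (hZ'.trans ((hZyK y hy).trans ?_)) (hZ.trans hCH), h⟩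
      exact insert_subset ((union_subset hY₁ hY₂H) hy) (union_subset hK₁H hK₂H)
    rcases mem_union.1 hy with hy | hy
    · obtain ⟨hZyK₁, -, hbin⟩ := hdata₁ y hy
      rcases hcount with hc | hc
      · obtain ⟨Z, hZ, hr⟩ := exists_isRooted_of_forall_hasTop (htop (min a b) (min_le_left _ _))
          hxH hbelow (fun z hz => (mem_filter.1 hz).2)
          (by have := hpow (min a b) ((min_le_left _ _).trans ha.le); omega)
        obtain ⟨Z', hZ', hsub, hr₁, hr₂⟩ := hclose b _ Z (hZ.trans hins) hbin hr (min_le_right _ _)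
        rcases le_total a b with hab | hab
        · rw [min_eq_left hab] at hr₂
          refine Or.inl (hH.forall_hasTop ha hsub hr₂ fun z hz => ?_)
          rcases mem_union.1 hz with hz | hz
          · rcases mem_insert.1 (hZyK₁ (hZ' hz)) with rfl | hz
            · exact (hY₁C z hy x hx).le
            · exact (hK₁C z hz x hx).le
          · rcases mem_insert.1 (hZ hz) with rfl | hz
            · exact le_rfl
            · exact (mem_filter.1 hz).2.le
        · rw [min_eq_right hab] at hr₁
          refine Or.inr (Or.inl (hH.forall_hasBot hb hsub hr₁ fun z hz => ?_))
          rcases mem_union.1 hz with hz | hz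
          · rcases mem_insert.1 (hZyK₁ (hZ' hz)) with rfl | hz
            · exact le_rfl
            · exact (hY₁K₁ y hy z hz).le
          · exact (hY₁C y hy z (hins (hZ hz))).le
      · obtain ⟨Z, hZ, hr⟩ := exists_isRooted_of_forall_hasBot (hbot b le_rfl)
          hxH habove (fun z hz => (mem_filter.1 hz).2) (by have := hpow b hb.le; omega)
        obtain ⟨Z', hZ', hsub, hr₁, -⟩ := hclose b _ Z (hZ.trans hins) hbin hr le_rfl
        refine Or.inr (Or.inl (hH.forall_hasBot hb hsub hr₁ fun z hz => ?_))
        rcases mem_union.1 hz with hz | hz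
        · rcases mem_insert.1 (hZyK₁ (hZ' hz)) with rfl | hz
          · exact le_rfl
          · exact (hY₁K₁ y hy z hz).le
        · exact (hY₁C y hy z (hins (hZ hz))).le
    · obtain ⟨hZyK₂, -, hbin⟩ := hdata₂ y hy
      rcases hcount with hc | hc
      · obtain ⟨Z, hZ, hr⟩ := exists_isRooted_of_forall_hasTop (htop a le_rfl)
          hxH hbelow (fun z hz => (mem_filter.1 hz).2) (by have := hpow a ha.le; omega)
        obtain ⟨Z', hZ', hsub, hr₁, -⟩ := hclose a _ Z (hZ.trans hins) hbin hr le_rfl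
        refine Or.inl (hH.forall_hasTop ha hsub hr₁ fun z hz => ?_)
        rcases mem_union.1 hz with hz | hz
        · rcases mem_insert.1 (hZyK₂ (hZ' hz)) with rfl | hz
          · exact le_rfl
          · exact (hlt₄ z hz y hy).le
        · exact (hCY₂ z (hins (hZ hz)) y hy).le
      · obtain ⟨Z, hZ, hr⟩ := exists_isRooted_of_forall_hasBot (hbot (min a b) (min_le_right _ _))
          hxH habove (fun z hz => (mem_filter.1 hz).2)
          (by have := hpow (min a b) ((min_le_left _ _).trans ha.le); omega)
        obtain ⟨Z', hZ', hsub, hr₁, hr₂⟩ := hclose a _ Z (hZ.trans hins) hbin hr (min_le_left _ _)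
        rcases le_total a b with hab | hab
        · rw [min_eq_left hab] at hr₁
          refine Or.inl (hH.forall_hasTop ha hsub hr₁ fun z hz => ?_)
          rcases mem_union.1 hz with hz | hz
          · rcases mem_insert.1 (hZyK₂ (hZ' hz)) with rfl | hz
            · exact le_rfl
            · exact (hlt₄ z hz y hy).le
          · exact (hCY₂ z (hins (hZ hz)) y hy).le
        · rw [min_eq_right hab] at hr₂
          refine Or.inr (Or.inl (hH.forall_hasBot hb hsub hr₂ fun z hz => ?_))
          rcases mem_union.1 hz with hz | hz
          · rcases mem_insert.1 (hZyK₂ (hZ' hz)) with rfl | hz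
            · exact (hCY₂ x hx z hy).le
            · exact (hCK₂ x hx z hz).le
          · rcases mem_insert.1 (hZ hz) with rfl | hz
            · exact le_rfl
            · exact (mem_filter.1 hz).2.le

/-- Every tree on `m` vertices is present in a large homogeneous set. -/
theorem IsHomogeneous.exists_isParentEmb {p : ℕ → ℕ} (hp : ∀ i, 0 < i → p i < i) {m : ℕ}
    (hm : 0 < m) {H : Finset L} (hAL : AttachOrLink G B) (hne : ∀ i, (B i).Nonempty)
    (hH : IsHomogeneous G B p m H) (hHc : 2 * m + 4 * 2 ^ m ≤ #H) :
    ∃ (Z : Finset L) (τ : SimpleGraph L) (φ : ℕ → L), IsPresent G B Z τ ∧ (∀ i < m, φ i ∈ Z) ∧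
      IsParentEmb p τ m φ := by
  have hbin : ∀ Z r, IsRooted G B m Z r → ∃ (Z : Finset L) (τ : SimpleGraph L) (φ : ℕ → L),
      IsPresent G B Z τ ∧ (∀ i < m, φ i ∈ Z) ∧ IsParentEmb p τ m φ := by
    rintro Z r ⟨τ, hpres, hb⟩
    obtain ⟨φ, hφ, h1, h2⟩ := hb.exists_isParentEmb hp
    exact ⟨Z, τ, φ, hpres, fun i hi => hφ i (by omega),
      fun i hi j hj => h1 i (by omega) j (by omega), fun i hi j hj => h2 i (by omega) j (by omega)⟩
  have hpow : m < 2 ^ m := Nat.lt_two_pow_self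
  -- Induction on the slack `n` in `a + b + s ≤ 3m`.
  suffices hmain : ∀ n a b s, a ≤ m → b ≤ m → 0 < s → s ≤ m → m + m + m ≤ a + b + s + n →
      (∀ k ≤ a, ∀ Z ⊆ H, #Z = 2 ^ k → HasTop G B k Z) →
      (∀ k ≤ b, ∀ Z ⊆ H, #Z = 2 ^ k → HasBot G B k Z) →
      (∃ j, ∀ Z ⊆ H, #Z = s → HasParentTree G B p s j Z) →
      ∃ (Z : Finset L) (τ : SimpleGraph L) (φ : ℕ → L), IsPresent G B Z τ ∧ (∀ i < m, φ i ∈ Z) ∧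
        IsParentEmb p τ m φ by
    have hsingle : ∀ r, IsPresent G B {r} ⊥ := by
      intro r
      obtain ⟨v, hv⟩ := hne r
      refine ⟨fun _ => v, fun i hi => ?_, fun i _ j _ => by simp⟩
      rwa [mem_singleton.1 hi]
    refine hmain (m + m + m) 0 0 1 (by omega) (by omega) (by omega) (by omega) (by omega) ?_ ?_ ?_
    · intro k hk Z _ hc
      obtain rfl : k = 0 := by omega
      obtain ⟨r, rfl⟩ := card_eq_one.1 hc
      exact ⟨r, by simp, ⊥, hsingle r, rfl⟩
    · intro k hk Z _ hc
      obtain rfl : k = 0 := by omega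
      obtain ⟨r, rfl⟩ := card_eq_one.1 hc
      exact ⟨r, by simp, ⊥, hsingle r, rfl⟩
    · refine ⟨0, fun Z _ hc => ?_⟩
      obtain ⟨r, rfl⟩ := card_eq_one.1 hc
      refine ⟨⊥, fun _ => r, hsingle r, ⟨fun i hi j hj _ => by omega, fun i hi j hj => ?_⟩,
        by simp, by simp⟩
      simp only [SimpleGraph.irrefl, ParentAdj, false_iff]
      omega
  intro n
  induction n with
  | zero =>
    intro a b s ha hb hs hsm hsum htop hbot htree
    obtain ⟨Z, hZ, hZc⟩ := exists_subset_card_eq (s := H) (n := 2 ^ a)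
      (by rw [show a = m by omega]; omega)
    obtain ⟨r, -, hr⟩ := htop a le_rfl Z hZ hZc
    exact hbin Z r (by rwa [show m = a by omega])
  | succ n ih =>
    intro a b s ha hb hs hsm hsum htop hbot htree
    rcases ha.eq_or_lt with rfl | ha
    · obtain ⟨Z, hZ, hZc⟩ := exists_subset_card_eq (s := H) (n := 2 ^ a) (by omega)
      obtain ⟨r, -, hr⟩ := htop a le_rfl Z hZ hZc
      exact hbin Z r hr
    rcases hb.eq_or_lt with rfl | hb
    · obtain ⟨Z, hZ, hZc⟩ := exists_subset_card_eq (s := H) (n := 2 ^ b) (by omega)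
      obtain ⟨r, -, hr⟩ := hbot b le_rfl Z hZ hZc
      exact hbin Z r hr
    rcases hsm.eq_or_lt with rfl | hsm
    · obtain ⟨j, hj⟩ := htree
      obtain ⟨Z, hZ, hZc⟩ := exists_subset_card_eq (s := H) (n := s) (by omega)
      obtain ⟨τ, φ, hpres, hemb, rfl, -⟩ := hj Z hZ hZc
      exact ⟨_, τ, φ, hpres, fun i hi => mem_image_of_mem _ (mem_range.2 hi), hemb⟩
    rcases hH.exists_larger_tree hp hAL hHc ha hb hs hsm htop hbot htree with h | h | h
    · refine ih (a + 1) b s ha hb.le hs hsm.le (by omega) (fun k hk => ?_) hbot htree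
      rcases Nat.le_succ_iff.1 hk with hk | rfl
      · exact htop k hk
      · exact h
    · refine ih a (b + 1) s ha.le hb hs hsm.le (by omega) htop (fun k hk => ?_) htree
      rcases Nat.le_succ_iff.1 hk with hk | rfl
      · exact hbot k hk
      · exact h
    · exact ih a b (s + 1) ha.le hb.le (by omega) hsm (by omega) htop hbot h

end Progress

/-! ### Forests inside parent trees -/

section Forests

/-- At the end of a longest path, a neighbour off the path would lengthen it, and one on it other
than the penultimate vertex would close a cycle. -/
theorem SimpleGraph.IsAcyclic.exists_subsingleton_neighborSet {U : Type*} [Finite U] [Nonempty U]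
    {H : SimpleGraph U} (h : H.IsAcyclic) : ∃ v, (H.neighborSet v).Subsingleton := by
  classical
  have := Fintype.ofFinite U
  obtain ⟨u, v, p, hp, hmax⟩ := SimpleGraph.Walk.exists_isPath_forall_isPath_length_le_length H
  have key : ∀ w, H.Adj v w → w = p.penultimate := by
    intro w hw
    refine h.eq_penultimate_of_adj_end hp hw ?_
    by_contra hws
    have := hmax _ _ _ (hp.concat hws hw)
    simp at this
  exact ⟨v, fun w hw w' hw' => (key w hw).trans (key w' hw').symm⟩

/-- Remove a vertex with at most one neighbour in `A`, place the rest, then put it back at a new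
position. -/
theorem SimpleGraph.IsAcyclic.exists_parentAdj_on {U : Type*} [DecidableEq U] {H : SimpleGraph U}
    (h : H.IsAcyclic) (A : Finset U) :
    ∃ (p : ℕ → ℕ) (m : ℕ) (ψ : U → ℕ), (∀ i, 0 < i → p i < i) ∧ 0 < m ∧ (∀ u ∈ A, ψ u < m) ∧
      Set.InjOn ψ A ∧ ∀ u ∈ A, ∀ v ∈ A, H.Adj u v ↔ ParentAdj p (ψ u) (ψ v) := by
  induction hn : #A generalizing A with
  | zero =>
    rw [card_eq_zero] at hn
    subst hn
    exact ⟨fun _ => 0, 1, fun _ => 0, fun _ hi => hi, one_pos, by simp, by simp, by simp⟩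
  | succ n ih =>
    obtain ⟨w, hw⟩ := card_pos.1 (by omega : 0 < #A)
    have : Nonempty (A : Set U) := ⟨⟨w, hw⟩⟩
    obtain ⟨⟨v, hvA⟩, hv⟩ := (h.induce (A : Set U)).exists_subsingleton_neighborSet
    have hvA' : v ∈ A := hvA
    have hleaf : ∀ u ∈ A, ∀ u' ∈ A, H.Adj v u → H.Adj v u' → u = u' := fun u hu u' hu' h1 h2 =>
      congrArg Subtype.val (@hv ⟨u, hu⟩ h1 ⟨u', hu'⟩ h2)
    obtain ⟨p, m, ψ, hp, hm, hψ, hinj, hadj⟩ := ih (A.erase v) (by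
      rw [card_erase_of_mem hvA']
      omega)
    -- it suffices to find a place `k` for `v` in a larger tree
    suffices hex : ∃ (p' : ℕ → ℕ) (k : ℕ), m ≤ k ∧ (∀ i, 0 < i → p' i < i) ∧
        (∀ i < m, p' i = p i) ∧ ∀ u ∈ A.erase v, H.Adj v u ↔ p' k = ψ u by
      obtain ⟨p', k, hmk, hp', hpp', hk⟩ := hex
      have h0 : ∀ u ∈ A, u ≠ v → Function.update ψ v k u = ψ u := fun u _ hu =>
        Function.update_of_ne hu _ _
      have h1 : Function.update ψ v k v = k := Function.update_self _ _ _
      have hk' : ∀ u ∈ A, u ≠ v → (H.Adj v u ↔ ParentAdj p' k (ψ u)) := by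
        intro u hu huv
        have h2 := hψ u (mem_erase.2 ⟨huv, hu⟩)
        rw [hk u (mem_erase.2 ⟨huv, hu⟩)]
        refine ⟨fun h => Or.inl ⟨by omega, h⟩, ?_⟩
        rintro (⟨-, h⟩ | ⟨h3, h4⟩)
        · exact h
        · have := hp' _ h3
          omega
      refine ⟨p', k + 1, Function.update ψ v k, hp', by omega, fun u hu => ?_, ?_, ?_⟩
      · by_cases huv : u = v
        · rw [huv, h1]
          omega
        · rw [h0 u hu huv]
          have := hψ u (mem_erase.2 ⟨huv, hu⟩)
          omega
      · intro u hu u' hu' heq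
        by_cases huv : u = v <;> by_cases huv' : u' = v
        · rw [huv, huv']
        · rw [huv, h1, h0 u' hu' huv'] at heq
          have := hψ u' (mem_erase.2 ⟨huv', hu'⟩)
          omega
        · rw [huv', h1, h0 u hu huv] at heq
          have := hψ u (mem_erase.2 ⟨huv, hu⟩)
          omega
        · rw [h0 u hu huv, h0 u' hu' huv'] at heq
          exact hinj (mem_erase.2 ⟨huv, hu⟩) (mem_erase.2 ⟨huv', hu'⟩) heq
      · intro u hu u' hu'
        by_cases huv : u = v <;> by_cases huv' : u' = v
        · rw [huv, huv', h1]
          simp only [SimpleGraph.irrefl, ParentAdj, false_iff]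
          have := hp' k
          omega
        · rw [huv, h1, h0 u' hu' huv', hk' u' hu' huv']
        · rw [huv', h1, h0 u hu huv, H.adj_comm, hk' u hu huv, ParentAdj, ParentAdj, or_comm]
        · have e1 := mem_erase.2 ⟨huv, hu⟩
          have e2 := mem_erase.2 ⟨huv', hu'⟩
          rw [h0 u hu huv, h0 u' hu' huv', hadj u e1 u' e2, ParentAdj, ParentAdj,
            hpp' _ (hψ u e1), hpp' _ (hψ u' e2)]
    have hupd : ∀ (q : ℕ → ℕ) (k a : ℕ), (∀ i, 0 < i → q i < i) → a < k →
        ∀ i, 0 < i → Function.update q k a i < i := by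
      intro q k a hq ha i hi
      by_cases hik : i = k
      · rw [hik, Function.update_self]
        exact ha
      · rw [Function.update_of_ne hik]
        exact hq i hi
    by_cases hex : ∃ u ∈ A.erase v, H.Adj v u
    · obtain ⟨u, hu, hvu⟩ := hex
      refine ⟨Function.update p m (ψ u), m, le_rfl, hupd p m _ hp (hψ u hu),
        fun i hi => Function.update_of_ne hi.ne _ _, fun u' hu' => ?_⟩
      rw [Function.update_self]
      refine ⟨fun h => ?_, fun h => ?_⟩
      · rw [hleaf u (mem_of_mem_erase hu) u' (mem_of_mem_erase hu') hvu h]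
      · rwa [← hinj hu hu' h]
    · push Not at hex
      -- A vertex isolated in `A` hangs from the filler position `m`, which represents no vertex of
      -- `A`.
      refine ⟨Function.update (Function.update p m 0) (m + 1) m, m + 1, by omega,
        hupd _ _ _ (hupd p m 0 hp hm) (by omega), fun i hi => ?_, fun u' hu' => ?_⟩
      · rw [Function.update_of_ne (by omega), Function.update_of_ne hi.ne]
      · rw [Function.update_self]
        have := hψ u' hu'
        exact ⟨fun h => absurd h (hex u' hu'), fun h => by omega⟩

end Forests

/-! ### Assembling the proof -/

section Main

open scoped Classical

theorem exists_equal_blocks {V : Type*} [Fintype V] (N S : ℕ) (h : N * S ≤ Fintype.card V) :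
    ∃ B : Fin N → Finset V, (∀ i, #(B i) = S) ∧ ∀ i j, i ≠ j → Disjoint (B i) (B j) := by
  obtain ⟨g⟩ := Function.Embedding.nonempty_of_card_le (α := Fin N × Fin S) (β := V) (by simpa)
  refine ⟨fun i => univ.image fun j => g (i, j), fun i => ?_, fun i j hij => ?_⟩
  · rw [card_image_of_injective _ fun a b hab => by simpa using hab]
    simp
  · rw [disjoint_left]
    intro v hv hv'
    obtain ⟨a, -, rfl⟩ := mem_image.1 hv
    obtain ⟨b, -, hb⟩ := mem_image.1 hv'
    exact hij (by simpa using (congrArg Prod.fst (g.injective hb)).symm)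

/-- Colour an index set by the collection of all relevant properties it has, so that one application
of Ramsey's theorem treats all of them. -/
theorem exists_isHomogeneous (p : ℕ → ℕ) (m h : ℕ) : ∃ N, ∀ {V : Type*} (G : SimpleGraph V)
    (B : Fin N → Finset V), ∃ H, #H = h ∧ IsHomogeneous G B p m H := by
  obtain ⟨N, hN⟩ := exists_bounded_ramsey
    (Set (Fin (m + 1) ⊕ Fin (m + 1) ⊕ Fin (m + 1) × Fin (m + 1))) (2 ^ m) h
  refine ⟨N, fun {V} G B => ?_⟩
  obtain ⟨H, -, hc, hH⟩ := hN (univ : Finset (Fin N)) (fun A =>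
    {t | Sum.elim (fun k : Fin (m + 1) => HasTop G B k A)
      (Sum.elim (fun k : Fin (m + 1) => HasBot G B k A)
        fun x : Fin (m + 1) × Fin (m + 1) => HasParentTree G B p x.1 x.2 A) t}) (by simp)
  have hpow : ∀ k ≤ m, 2 ^ k ≤ 2 ^ m := fun k hk => Nat.pow_le_pow_right (by norm_num) hk
  have hm : m < 2 ^ m := Nat.lt_two_pow_self
  refine ⟨H, hc, ⟨fun A hA A' hA' k hk hAc hAc' h => ?_, fun A hA A' hA' k hk hAc hAc' h => ?_,
    fun A hA A' hA' s hs hAc hAc' j hj h => ?_⟩⟩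
  · have e := hH A hA A' hA' (by rw [hAc, hAc']) (hAc ▸ hpow k hk)
    exact (Set.ext_iff.1 e (Sum.inl ⟨k, by omega⟩)).1 h
  · have e := hH A hA A' hA' (by rw [hAc, hAc']) (hAc ▸ hpow k hk)
    exact (Set.ext_iff.1 e (Sum.inr (Sum.inl ⟨k, by omega⟩))).1 h
  · have e := hH A hA A' hA' (by rw [hAc, hAc']) (by omega)
    exact (Set.ext_iff.1 e (Sum.inr (Sum.inr (⟨s, by omega⟩, ⟨j, by omega⟩)))).1 h

/-- A graph with small degrees and no large anticomplete pairs contains every small tree. -/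
theorem exists_induced_parentTree {p : ℕ → ℕ} (hp : ∀ i, 0 < i → p i < i) {m : ℕ} (hm : 0 < m) :
    ∃ F : ℕ, 0 < F ∧ ∀ {V : Type*} [Fintype V] (G : SimpleGraph V) (E : ℕ), 1 ≤ E →
      (∀ v (X : Finset V), #(X.filter (G.Adj v)) ≤ E) →
      (∀ X X' : Finset V, Disjoint X X' → E ≤ #X → E ≤ #X' → ∃ a ∈ X, ∃ b ∈ X', G.Adj a b) →
      F * E ≤ Fintype.card V →
      ∃ φ : ℕ → V, (∀ i < m, ∀ j < m, φ i = φ j → i = j) ∧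
        ∀ i < m, ∀ j < m, G.Adj (φ i) (φ j) ↔ ParentAdj p i j := by
  obtain ⟨N, hN⟩ := exists_isHomogeneous p m (2 * m + 4 * 2 ^ m)
  set M := Nat.card (Finset (Fin N) × SimpleGraph (Fin N)) with hM
  -- The first factor pays for at most `M` shrinkings, one per pattern; the second is the size
  -- relative to `E` that the dichotomy requires. `N + 1` keeps both positive.
  set F := (200 * (N + 1) ^ 3) ^ M * (1000 * (N + 1) ^ 3) with hF
  have hq : 1 ≤ 200 * (N + 1) ^ 3 := Nat.mul_pos (by norm_num) (pow_pos (by omega) _)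
  have hF0 : 0 < F := Nat.mul_pos (pow_pos hq _) (Nat.mul_pos (by norm_num) (pow_pos (by omega) _))
  refine ⟨(N + 1) * F, Nat.mul_pos (by omega) hF0, fun {V} _ G E hE hdeg hedge hcard => ?_⟩
  obtain ⟨B₀, hB₀, hdisj₀⟩ := exists_equal_blocks (V := V) N (F * E) (by
    refine le_trans (Nat.mul_le_mul_right _ (by omega : N ≤ N + 1)) ?_
    rwa [← mul_assoc])
  obtain ⟨B, S, hsub, hB, hS, hst⟩ := exists_isStable G hq M B₀ (F * E) hB₀
    ((Set.ncard_le_ncard (Set.subset_univ _) (Set.toFinite _)).trans (Set.ncard_univ _).le)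
  have hS' : 1000 * (N + 1) ^ 3 * E ≤ S := by
    rw [hF, mul_assoc] at hS
    exact Nat.le_of_mul_le_mul_left hS (pow_pos hq _)
  have hdisj : ∀ i j, i ≠ j → Disjoint (B i) (B j) := fun i j hij =>
    disjoint_of_subset_left (hsub i) (disjoint_of_subset_right (hsub j) (hdisj₀ i j hij))
  have hAL : AttachOrLink G B := hst.attachOrLink hdeg hedge hE
    (fun X => (card_le_univ X).trans (by simp)) hB hdisj hS'
  have hS0 : 0 < S := lt_of_lt_of_le
    (Nat.mul_pos (Nat.mul_pos (by norm_num) (pow_pos (by omega) _)) hE) hS'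
  obtain ⟨H, hHc, hH⟩ := hN G B
  obtain ⟨Z, τ, φ, ⟨f, hf, hadj⟩, hφ, hinj, hemb⟩ := hH.exists_isParentEmb hp hm hAL
    (fun i => card_pos.1 (by rw [hB i]; exact hS0)) hHc.ge
  refine ⟨fun i => f (φ i), fun i hi j hj hij => hinj i hi j hj ?_, fun i hi j hj => ?_⟩
  · by_contra hne
    refine disjoint_left.1 (hdisj _ _ hne) (hf _ (hφ i hi)) ?_
    dsimp only at hij
    rw [hij]
    exact hf _ (hφ j hj)
  · rw [hadj _ (hφ i hi) _ (hφ j hj), hemb i hi j hj]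

end Main

/-- Otherwise all degrees are zero, and two singletons form a forbidden anticomplete pair. -/
theorem SimpleGraph.IsCoherent.one_le {V : Type*} [Fintype V] {G : SimpleGraph V}
    [DecidableRel G.Adj] {ε : ℝ} (h : G.IsCoherent ε) : 1 ≤ ε * (Fintype.card V : ℝ) := by
  by_contra! hlt
  obtain ⟨u, v, huv⟩ := Fintype.one_lt_card_iff.1 h.one_lt_card
  refine h.not_exists_anticomplete ⟨{u}, {v}, ⟨by simpa using huv, ?_⟩, by simpa using hlt.le,
    by simpa using hlt.le⟩
  intro a ha b hb hab
  rw [mem_singleton] at ha hb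
  subst ha hb
  have h1 : (G.degree a : ℝ) < 1 := (h.degree_lt a).trans hlt
  have h2 : 0 < G.degree a := (G.degree_pos_iff_exists_adj a).2 ⟨b, hab⟩
  have h3 : G.degree a < 1 := by exact_mod_cast h1
  omega

theorem SimpleGraph.IsAcyclic.exists_isIndContained_of_isCoherent {U : Type*} [Finite U]
    {H : SimpleGraph U} (hH : H.IsAcyclic) : ∃ ε : ℝ, 0 < ε ∧
      ∀ {V : Type*} [Fintype V] (G : SimpleGraph V) [DecidableRel G.Adj],
        G.IsCoherent ε → H.IsIndContained G := by
  classical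
  have := Fintype.ofFinite U
  obtain ⟨p, m, ψ, hp, hm, hψ, hinj, hadj⟩ := hH.exists_parentAdj_on univ
  obtain ⟨F, hF, hmain⟩ := exists_induced_parentTree hp hm
  have hF' : (0 : ℝ) < F := by exact_mod_cast hF
  -- Rounding `x ≥ 1` up at most doubles it, whence the factor 2: `F * ⌈x⌉₊ ≤ F * (2 * x) = |G|`.
  refine ⟨1 / (2 * F), by positivity, fun {V} _ G _ hG => ?_⟩
  have hone := hG.one_le
  set x : ℝ := 1 / (2 * F) * (Fintype.card V : ℝ) with hx
  have hxle : x ≤ ⌈x⌉₊ := Nat.le_ceil x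
  obtain ⟨φ, hφ, hφadj⟩ := hmain G ⌈x⌉₊ (Nat.one_le_ceil_iff.2 (by linarith))
    (fun v X => by
      have h1 : (G.degree v : ℝ) ≤ (⌈x⌉₊ : ℝ) := (hG.degree_lt v).le.trans hxle
      refine le_trans (card_le_card (t := G.neighborFinset v) fun w hw => ?_) ?_
      · rw [SimpleGraph.mem_neighborFinset]
        exact ((@mem_filter _ _ (_) _ _).1 hw).2
      · rw [G.card_neighborFinset_eq_degree]
        exact_mod_cast h1)
    (fun X X' hd h1 h2 => by
      by_contra! hcon
      exact hG.not_exists_anticomplete ⟨X, X', ⟨hd, hcon⟩, hxle.trans (by exact_mod_cast h1),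
        hxle.trans (by exact_mod_cast h2)⟩)
    (by
      have h1 : (⌈x⌉₊ : ℝ) ≤ 2 * x := by
        have := (Nat.ceil_lt_add_one (by linarith : 0 ≤ x)).le
        linarith
      have h2 : (F : ℝ) * ⌈x⌉₊ ≤ Fintype.card V := by
        calc (F : ℝ) * ⌈x⌉₊ ≤ F * (2 * x) := by gcongr
          _ = Fintype.card V := by rw [hx]; field_simp
      exact_mod_cast h2)
  refine ⟨⟨⟨fun u => φ (ψ u), fun u v huv => ?_⟩, fun {u v} => ?_⟩⟩
  · exact hinj (mem_univ _) (mem_univ _) (hφ _ (hψ u (mem_univ _)) _ (hψ v (mem_univ _)) huv)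
  · exact (hφadj _ (hψ u (mem_univ _)) _ (hψ v (mem_univ _))).trans
      (hadj u (mem_univ _) v (mem_univ _)).symm

end

theorem mainTheorem1 :
    (∀ {U : Type*} [Finite U] (H : SimpleGraph U), H.IsAcyclic →
      ∃ ε : ℝ, 0 < ε ∧
        ∀ {V : Type*} [Fintype V] (G : SimpleGraph V) [DecidableRel G.Adj],
          1 < Fintype.card V → ¬ H.IsIndContained G →
            (∃ v : V, ε * (Fintype.card V : ℝ) ≤ (G.degree v : ℝ)) ∨
            (∃ A B : Finset V, G.IsAnticompletePair A B ∧
              ε * (Fintype.card V : ℝ) ≤ (A.card : ℝ) ∧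
              ε * (Fintype.card V : ℝ) ≤ (B.card : ℝ))) ∧
    (∀ {U : Type*} [Finite U] (T : SimpleGraph U), T.IsTree →
      ∃ ε : ℝ, 0 < ε ∧
        ∀ {V : Type*} [Fintype V] (G : SimpleGraph V) [DecidableRel G.Adj],
          G.IsCoherent ε → T.IsIndContained G) := by
  refine ⟨fun {U} _ H hH => ?_, fun {U} _ T hT => hT.2.exists_isIndContained_of_isCoherent⟩
  obtain ⟨ε, hε, h⟩ := hH.exists_isIndContained_of_isCoherent
  refine ⟨ε, hε, fun {V} _ G _ hV hfree => ?_⟩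
  by_contra! hcon
  refine hfree (h G ⟨hV, hcon.1, ?_⟩)
  rintro ⟨A, B, hAB, hA, hB⟩
  exact absurd hB (not_le.2 (hcon.2 A B hAB hA))
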